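/- Let $n\ge 2$ and $m>2$ be integers and let $q\in\mathbb C$ be a primitive $m$th root of unity. Put $m'=m$ if $m$ is odd and $m'=m/2$ if $m$ is even. Let $\beta,\mu_1,\dots,\mu_{n-1},\nu_1,\dots,\nu_{n-1}$ be the simple roots of $A_{2n-1}$, let $P$ be the weight lattice, freely generated by the corresponding fundamental weights, and let $(\cdot\,|\,\cdot)$ be the pairing between $P$ and the root lattice for which fundamental weights and simple roots are dual bases. For $1\le i,j\le n$ put $\alpha_{i,j}=\mu_1+\dots+\mu_{i-1}+\beta+\nu_1+\dots+\nu_{j-1}$. Let $B$ be the semidirect product of the standard quantized matrix algebra $M_q(n)$ with the Laurent polynomial algebra $\mathbb C[L_1^{\pm1},\dots,L_{2n-1}^{\pm1}]$. That is, $B$ is the unital associative $\mathbb C$-algebra with generators $Z_{i,j}$ $(1\le i,j\le n)$ and $L_\xi$ $(\xi\in P)$ and relations $$Z_{i,j}Z_{i,k}=qZ_{i,k}Z_{i,j}\ (j<k),\qquad Z_{i,j}Z_{k,j}=qZ_{k,j}Z_{i,j}\ (i<k),\qquad Z_{i,j}Z_{s,t}=Z_{s,t}Z_{i,j}\ (i<s,\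 t<j),$$ $$Z_{i,j}Z_{s,t}=Z_{s,t}Z_{i,j}+(q-q^{-1})Z_{i,t}Z_{s,j}\ (i<s,\ j<t),$$ $$L_0=1,\qquad L_\xi L_\eta=L_{\xi+\eta},\qquad L_\xi Z_{i,j}=q^{(\xi|\alpha_{i,j})}Z_{i,j}L_\xi .$$ Let $\wp=(\zeta_1,\dots,\zeta_n,\xi_1,\dots,\xi_n)\in P^{2n}$, put $\tilde Z_{i,j}=Z_{i,j}L_{\zeta_i}L_{\xi_j}$, and let the modified algebra $M_q^\wp(n)$ be the subalgebra of $B$ generated by all $\tilde Z_{i,j}$. Assume that $$\tilde Z_{i,n+1-i}\,\tilde Z_{j,n+1-j}=\tilde Z_{j,n+1-j}\,\tilde Z_{i,n+1-i}\qquad\text{for all } i,j.$$ For $\Lambda=(\lambda_1,\dots,\lambda_n)\in\mathbb C^n$ let $I(\Lambda)$ be the left ideal of $M_q^\wp(n)$ generated by the elements $\tilde Z_{i,j}$ with $i+j\ge n+2$, the elements $\tilde Z_{k,n+1-k}-\lambda_k$ with $1\le k\le n$, and the elements $\tilde Z_{i,j}^{m'}$ with $i+j\le n$. Then the restricted Verma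 module $\overline{M_\wp(\Lambda)}=M_q^\wp(n)/I(\Lambda)$ is an irreducible left $M_q^\wp(n)$-module if and only if $\lambda_i\ne0$ for all $i=1,\dots,n$. -/

import Mathlib

/-- The simple roots of `A_{2n-1}`: the noncompact root `β = inl ()`, the compact roots
`μ_1, …, μ_{n-1}` (`inr (inl a)`, `a = 0, …, n-2`) and `ν_1, …, ν_{n-1}` (`inr (inr b)`). -/
abbrev SimpleRoot (n : ℕ) : Type := Unit ⊕ (Fin (n - 1) ⊕ Fin (n - 1))

/-- The weight lattice `P`, in coordinates with respect to the fundamental weights. -/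
abbrev WeightLattice (n : ℕ) : Type := SimpleRoot n → ℤ

/-- The root lattice `Q`, in coordinates with respect to the simple roots. -/
abbrev RootLattice (n : ℕ) : Type := SimpleRoot n → ℤ

/-- The pairing `P × Q → ℤ` with `(λ_i | α_j) = δ_{ij}` (all `d_j = 1` in type `A`). -/
def weightPairing {n : ℕ} (ξ : WeightLattice n) (α : RootLattice n) : ℤ :=
  ∑ k, ξ k * α k

/-- The root `α_{i,j} = μ_1 + ⋯ + μ_{i-1} + β + ν_1 + ⋯ + ν_{j-1}` of `Z_{i,j}`. Indices in
`Fin n` start at `0`, so the one-based index `i` is the element of `Fin n` with value `i - 1`. -/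
def rootZ {n : ℕ} (i j : Fin n) : RootLattice n
  | Sum.inl _ => 1
  | Sum.inr (Sum.inl a) => if (a : ℕ) < (i : ℕ) then 1 else 0
  | Sum.inr (Sum.inr b) => if (b : ℕ) < (j : ℕ) then 1 else 0

/-- Generators of the semidirect product `ℂ[L_1^{±1}, …, L_{2n-1}^{±1}] ×_s M_q(n)`:
the `Z_{i,j}` and the torus elements `L_ξ`, `ξ ∈ P`. -/
inductive TorusMatrixGen (n : ℕ) : Type
  | Z (i j : Fin n) : TorusMatrixGen n
  | L (ξ : WeightLattice n) : TorusMatrixGen n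

/-- The free generator `Z_{i,j}`. -/
noncomputable def freeZ {n : ℕ} (i j : Fin n) : FreeAlgebra ℂ (TorusMatrixGen n) :=
  FreeAlgebra.ι ℂ (TorusMatrixGen.Z i j)

/-- The free generator `L_ξ`. -/
noncomputable def freeL {n : ℕ} (ξ : WeightLattice n) : FreeAlgebra ℂ (TorusMatrixGen n) :=
  FreeAlgebra.ι ℂ (TorusMatrixGen.L ξ)

/-- Defining relations: those of the standard quantized matrix algebra `M_q(n)`, those of the
group algebra of `P` (the Laurent polynomials in the `L_k`), and the cross relations
`L_ξ Z_{i,j} = q^{(ξ | α_{i,j})} Z_{i,j} L_ξ`. -/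
inductive TorusMatrixRel (n : ℕ) (q : ℂ) :
    FreeAlgebra ℂ (TorusMatrixGen n) → FreeAlgebra ℂ (TorusMatrixGen n) → Prop
  | row (i j k : Fin n) (hjk : j < k) :
      TorusMatrixRel n q (freeZ i j * freeZ i k) (q • (freeZ i k * freeZ i j))
  | col (i j k : Fin n) (hik : i < k) :
      TorusMatrixRel n q (freeZ i j * freeZ k j) (q • (freeZ k j * freeZ i j))
  | anti (i j s t : Fin n) (his : i < s) (htj : t < j) :
      TorusMatrixRel n q (freeZ i j * freeZ s t) (freeZ s t * freeZ i j)
  | diag (i j s t : Fin n) (his : i < s) (hjt : j < t) :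
      TorusMatrixRel n q (freeZ i j * freeZ s t)
        (freeZ s t * freeZ i j + (q - q⁻¹) • (freeZ i t * freeZ s j))
  | torusOne : TorusMatrixRel n q (freeL 0) 1
  | torusMul (ξ η : WeightLattice n) :
      TorusMatrixRel n q (freeL ξ * freeL η) (freeL (ξ + η))
  | cross (ξ : WeightLattice n) (i j : Fin n) :
      TorusMatrixRel n q (freeL ξ * freeZ i j)
        (q ^ weightPairing ξ (rootZ i j) • (freeZ i j * freeL ξ))

/-- The algebra `ℂ[L_1^{±1}, …, L_{2n-1}^{±1}] ×_s M_q(n)`. -/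
def TorusMatrixAlgebra (n : ℕ) (q : ℂ) : Type := RingQuot (TorusMatrixRel n q)

noncomputable instance instRingTorusMatrixAlgebra (n : ℕ) (q : ℂ) :
    Ring (TorusMatrixAlgebra n q) :=
  inferInstanceAs (Ring (RingQuot (TorusMatrixRel n q)))

noncomputable instance instAlgebraTorusMatrixAlgebra (n : ℕ) (q : ℂ) :
    Algebra ℂ (TorusMatrixAlgebra n q) :=
  inferInstanceAs (Algebra ℂ (RingQuot (TorusMatrixRel n q)))

/-- The quotient map from the free algebra. -/
noncomputable def toTorusMatrixAlgebra (n : ℕ) (q : ℂ) :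
    FreeAlgebra ℂ (TorusMatrixGen n) →ₐ[ℂ] TorusMatrixAlgebra n q :=
  RingQuot.mkAlgHom ℂ (TorusMatrixRel n q)

theorem toTorusMatrixAlgebra_rel {n : ℕ} {q : ℂ} {x y : FreeAlgebra ℂ (TorusMatrixGen n)}
    (h : TorusMatrixRel n q x y) : toTorusMatrixAlgebra n q x = toTorusMatrixAlgebra n q y :=
  RingQuot.mkAlgHom_rel ℂ h

/-- The element `Z_{i,j}`. -/
noncomputable def matZ (n : ℕ) (q : ℂ) (i j : Fin n) : TorusMatrixAlgebra n q :=
  toTorusMatrixAlgebra n q (freeZ i j)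

/-- The element `L_ξ`. -/
noncomputable def torusL (n : ℕ) (q : ℂ) (ξ : WeightLattice n) : TorusMatrixAlgebra n q :=
  toTorusMatrixAlgebra n q (freeL ξ)

/-- The datum `℘ = (ζ_1, …, ζ_n, ξ_1, …, ξ_n) ∈ P^{2n}`. -/
structure ModificationDatum (n : ℕ) : Type where
  ζ : Fin n → WeightLattice n
  ξ : Fin n → WeightLattice n

/-- The modified generator `Z̃_{i,j} = Z_{i,j} L_{ζ_i} L_{ξ_j}`. -/
noncomputable def modZ {n : ℕ} (q : ℂ) (w : ModificationDatum n) (i j : Fin n) :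
    TorusMatrixAlgebra n q :=
  matZ n q i j * torusL n q (w.ζ i) * torusL n q (w.ξ j)

/-- The modified algebra `M_q^℘(n)`: the subalgebra generated by all `Z̃_{i,j}`. -/
noncomputable def modifiedAlgebra {n : ℕ} (q : ℂ) (w : ModificationDatum n) :
    Subalgebra ℂ (TorusMatrixAlgebra n q) :=
  Algebra.adjoin ℂ {x | ∃ i j : Fin n, x = modZ q w i j}

/-- `Z̃_{i,j}` as an element of `M_q^℘(n)`. -/
noncomputable def modGen {n : ℕ} (q : ℂ) (w : ModificationDatum n) (i j : Fin n) :
    modifiedAlgebra q w :=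
  ⟨modZ q w i j, Algebra.subset_adjoin ⟨i, j, rfl⟩⟩

/-- The elements `Z̃_{i,n+1-i}` on the antidiagonal commute with each other. In one-based
indices `Fin.rev i` is `n + 1 - i`. -/
def AntidiagonalCommutes {n : ℕ} (q : ℂ) (w : ModificationDatum n) : Prop :=
  ∀ i j : Fin n, modGen q w i i.rev * modGen q w j j.rev =
    modGen q w j j.rev * modGen q w i i.rev

/-- `m' = m` for `m` odd and `m' = m / 2` for `m` even. -/
def reducedOrder (m : ℕ) : ℕ := if Even m then m / 2 else m

/-- The left ideal `I(Λ)` of `M_q^℘(n)` generated by the `Z̃_{i,j}` with `i + j ≥ n + 2`, the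
`Z̃_{k,n+1-k} - λ_k`, and the `Z̃_{i,j}^{m'}` with `i + j ≤ n` (one-based indices). -/
noncomputable def restrictedIdeal {n : ℕ} (m : ℕ) (q : ℂ) (w : ModificationDatum n)
    (Λ : Fin n → ℂ) : Submodule (modifiedAlgebra q w) (modifiedAlgebra q w) :=
  Submodule.span (modifiedAlgebra q w)
    ({x | ∃ i j : Fin n, n + 2 ≤ ((i : ℕ) + 1) + ((j : ℕ) + 1) ∧ x = modGen q w i j} ∪
     {x | ∃ k : Fin n,
        x = modGen q w k k.rev - algebraMap ℂ (modifiedAlgebra q w) (Λ k)} ∪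
     {x | ∃ i j : Fin n, ((i : ℕ) + 1) + ((j : ℕ) + 1) ≤ n ∧
        x = modGen q w i j ^ reducedOrder m})

/-- The restricted Verma module: the left module `M_q^℘(n) / I(Λ)`. -/
abbrev RestrictedVerma {n : ℕ} (m : ℕ) (q : ℂ) (w : ModificationDatum n)
    (Λ : Fin n → ℂ) : Type :=
  modifiedAlgebra q w ⧸ restrictedIdeal m q w Λ

/-! Put `e + 1 = m'` and reverse the columns, so that the antidiagonal becomes the diagonal. The
class of `1` in the quotient is then a highest weight vector: entries below the diagonal kill it,
diagonal entries act on it by scalars. By straightening, ordered monomials in the entries above the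
diagonal span the module. The `m'`-th power of an entry commutes up to scalars with all generators,
so for an entry above the diagonal it vanishes on the whole module, and the dimension is at most `m'
^ (n(n-1)/2)` (`finrank_restrictedVerma_le`).

The lower bound comes from a model. Out of `n(n-1)/2` truncated `q`-oscillators,
`nonempty_fockModule` builds a module over `M_q(n)` of exactly this dimension, cyclic on a highest
weight vector `v` with eigenvalues `1`, whose singular vectors are the multiples of `v`. Functions
on `P` with values in it carry an action of `B`. Write `f ⊗ v` for the function `η ↦ f η • v`. On
such vectors the antidiagonal generators act by weighted shifts of `f`; these commute by hypothesis
and preserve the `m`-periodic functions, so they have a common eigenfunction `f` with nonzero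
eigenvalues (`exists_eigenfunction`). Rescaling rows and columns turns the eigenvalues into `Λ`
(`modRep_diag`).

If no `λ_k` vanishes, the rescaling is invertible, and comparing dimensions identifies the
restricted Verma module with the submodule generated by `f ⊗ v`
(`mem_restrictedIdeal_of_modRep_eq_zero`). A nonzero submodule contains a singular vector
(`exists_singular`), necessarily of the form `g ⊗ v`. A functional that kills the images of the
upper entries forces `g ∈ ℂ f` (`pointwiseφ_mem`), so the submodule contains the generator.

If some `λ_k = 0`, there are neighbours `a`, `b = a + 1` with `λ_a λ_b = 0`. Then the entry `(a, b)`
sends `f ⊗ v` to a nonzero singular vector, and the same functional vanishes on the submodule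
generated by it, which is therefore proper. -/

/-! ### Spans of ordered monomials and straightening -/

/-- The smallest subspace which contains `T` and is stable under all operators in `F`. -/
def stableClosure {M : Type*} [AddCommGroup M] [Module ℂ M] (F : Set (Module.End ℂ M))
    (T : Submodule ℂ M) : Submodule ℂ M :=
  sInf {p | T ≤ p ∧ ∀ f ∈ F, ∀ u ∈ p, f u ∈ p}

section StableClosure

variable {M : Type*} [AddCommGroup M] [Module ℂ M] {F : Set (Module.End ℂ M)}
  {T : Submodule ℂ M}

theorem le_stableClosure : T ≤ stableClosure F T :=
  le_sInf fun _ hp => hp.1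

theorem apply_mem_stableClosure {f : Module.End ℂ M} (hf : f ∈ F) {u : M}
    (hu : u ∈ stableClosure F T) : f u ∈ stableClosure F T := by
  simp only [stableClosure, Submodule.mem_sInf] at hu ⊢
  exact fun p hp => hp.2 f hf u (hu p hp)

theorem stableClosure_le {p : Submodule ℂ M} (hT : T ≤ p) (hp : ∀ f ∈ F, ∀ u ∈ p, f u ∈ p) :
    stableClosure F T ≤ p :=
  sInf_le ⟨hT, hp⟩

/-- Induction principle: a subspace containing `T`, such that stability may be checked inside the
closure, contains the closure. -/
theorem stableClosure_induction {p : Submodule ℂ M} (hT : T ≤ p)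
    (hp : ∀ f ∈ F, ∀ u ∈ stableClosure F T, u ∈ p → f u ∈ p) : stableClosure F T ≤ p := by
  refine (stableClosure_le (le_inf le_stableClosure hT) ?_).trans
    (inf_le_right (a := stableClosure F T))
  exact fun f hf u hu => ⟨apply_mem_stableClosure hf hu.1, hp f hf u hu.1 hu.2⟩

end StableClosure

/-- Adjoining the powers of a nilpotent operator, which commutes up to scalars with operators under
which the subspace is stable. -/
theorem exists_stable_of_pow_eq_zero {M : Type*} [AddCommGroup M] [Module ℂ M] {e : ℕ}
    (p : Submodule ℂ M) [FiniteDimensional ℂ p] (x : Module.End ℂ M) (hx : x ^ e = 0) :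
    ∃ p' : Submodule ℂ M, p ≤ p' ∧ (∀ u ∈ p', x u ∈ p') ∧
      (∀ y : Module.End ℂ M, (∃ c : ℂ, y * x = c • (x * y)) → (∀ u ∈ p, y u ∈ p) →
        ∀ u ∈ p', y u ∈ p') ∧
      FiniteDimensional ℂ p' ∧ Module.finrank ℂ p' ≤ e * Module.finrank ℂ p := by
  refine ⟨(Finset.range e).sup fun k => p.map (x ^ k), ?_, ?_, ?_, ?_, ?_⟩
  -- For `e = 0` the supremum is empty, but then `hx` reads `1 = 0` and the whole space is zero.
  · rcases Nat.eq_zero_or_pos e with rfl | he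
    · intro u _
      have : u = 0 := by simpa using LinearMap.congr_fun hx u
      simp [this]
    · refine le_trans ?_ (Finset.le_sup (Finset.mem_range.2 he))
      rw [pow_zero, Module.End.one_eq_id, Submodule.map_id]
  · intro u hu
    suffices h : (Finset.range e).sup (fun k => p.map (x ^ k)) ≤
        ((Finset.range e).sup fun k => p.map (x ^ k)).comap x from h hu
    refine Finset.sup_le fun k hk => ?_
    rintro _ ⟨v, hv, rfl⟩
    rw [Submodule.mem_comap, ← Module.End.mul_apply, ← pow_succ']
    rcases (Nat.succ_le_of_lt (Finset.mem_range.1 hk)).eq_or_lt with h | h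
    · rw [← Nat.succ_eq_add_one, h, hx]
      simp
    · exact (Finset.le_sup (f := fun k => p.map (x ^ k)) (Finset.mem_range.2 h) :)
        (Submodule.mem_map_of_mem hv)
  · rintro y ⟨c, hc⟩ hy u hu
    suffices h : (Finset.range e).sup (fun k => p.map (x ^ k)) ≤
        ((Finset.range e).sup fun k => p.map (x ^ k)).comap y from h hu
    refine Finset.sup_le fun k hk => ?_
    rintro _ ⟨v, hv, rfl⟩
    have hcomm : ∀ k : ℕ, y * x ^ k = c ^ k • (x ^ k * y) := by
      intro k
      induction k with
      | zero => simp
      | succ k ih =>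
        rw [pow_succ, ← mul_assoc, ih, smul_mul_assoc, mul_assoc, hc, mul_smul_comm, smul_smul,
          mul_assoc, pow_succ]
    rw [Submodule.mem_comap, ← Module.End.mul_apply, hcomm]
    refine Submodule.smul_mem _ _ ?_
    exact (Finset.le_sup (f := fun k => p.map (x ^ k)) hk :) (Submodule.mem_map_of_mem (hy v hv))
  · exact Submodule.finiteDimensional_finset_sup _ _
  · have key : ∀ s : Finset ℕ, Module.finrank ℂ (s.sup fun k => p.map (x ^ k) : Submodule ℂ M) ≤
        s.card * Module.finrank ℂ p := by
      intro s
      induction s using Finset.induction_on with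
      | empty => simp
      | insert a s ha ih =>
        rw [Finset.sup_insert, Finset.card_insert_of_notMem ha, add_mul, one_mul, add_comm]
        have : FiniteDimensional ℂ (s.sup fun k => p.map (x ^ k) : Submodule ℂ M) :=
          Submodule.finiteDimensional_finset_sup _ _
        exact (Submodule.finrank_add_le_finrank_add_finrank _ _).trans
          (add_le_add (Submodule.finrank_map_le _ _) ih)
    simpa using key (Finset.range e)

/-- The operators are adjoined one at a time: skew-commutation preserves stability under the earlier
ones, and each multiplies the dimension by at most `e`. -/
theorem finrank_stableClosure_le {M : Type*} [AddCommGroup M] [Module ℂ M] {e : ℕ}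
    (F : Finset (Module.End ℂ M)) (hF : ∀ x ∈ F, ∀ y ∈ F, ∃ c : ℂ, x * y = c • (y * x))
    (hn : ∀ x ∈ F, x ^ e = 0) (T : Submodule ℂ M) [FiniteDimensional ℂ T] :
    FiniteDimensional ℂ (stableClosure (F : Set (Module.End ℂ M)) T) ∧
      Module.finrank ℂ (stableClosure (F : Set (Module.End ℂ M)) T) ≤
        e ^ F.card * Module.finrank ℂ T := by
  classical
  suffices h : ∃ p : Submodule ℂ M, T ≤ p ∧ (∀ f ∈ F, ∀ u ∈ p, f u ∈ p) ∧
      FiniteDimensional ℂ p ∧ Module.finrank ℂ p ≤ e ^ F.card * Module.finrank ℂ T by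
    obtain ⟨p, h1, h2, h3, h4⟩ := h
    have hle : stableClosure (F : Set (Module.End ℂ M)) T ≤ p := stableClosure_le h1 h2
    exact ⟨Submodule.finiteDimensional_of_le hle, (Submodule.finrank_mono hle).trans h4⟩
  induction F using Finset.induction_on with
  | empty => exact ⟨T, le_rfl, by simp, inferInstance, by simp⟩
  | insert x F hxF ih =>
    obtain ⟨p, h1, h2, h3, h4⟩ := ih
      (fun x hx y hy => hF x (Finset.mem_insert_of_mem hx) y (Finset.mem_insert_of_mem hy))
      (fun x hx => hn x (Finset.mem_insert_of_mem hx))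
    obtain ⟨p', g1, g2, g3, g4, g5⟩ :=
      exists_stable_of_pow_eq_zero p x (hn x (Finset.mem_insert_self _ _))
    refine ⟨p', h1.trans g1, ?_, g4, ?_⟩
    · intro f hf
      rcases Finset.mem_insert.1 hf with rfl | hf
      · exact g2
      · exact g3 f (hF f (Finset.mem_insert_of_mem hf) x (Finset.mem_insert_self _ _)) (h2 f hf)
    · rw [Finset.card_insert_of_notMem hxF, pow_succ', mul_assoc]
      exact g5.trans (Nat.mul_le_mul_left _ h4)

/-- Straightening relations, up to unspecified scalars, for a matrix of ring elements: entries in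
crossing position commute up to a scalar and a correction term, all others commute up to a
scalar. -/
structure Straightening {n : ℕ} {R : Type*} [Ring R] [Algebra ℂ R] (X : Fin n → Fin n → R) :
    Prop where
  skew : ∀ i j a b, ¬ (i < a ∧ b < j) → ¬ (a < i ∧ j < b) →
    ∃ c : ℂ, X i j * X a b = c • (X a b * X i j)
  cross : ∀ i j a b, a < i → j < b →
    ∃ c d : ℂ, X i j * X a b = c • (X a b * X i j) + d • (X a j * X i b)

theorem Straightening.map {n : ℕ} {R S : Type*} [Ring R] [Algebra ℂ R] [Ring S] [Algebra ℂ S]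
    {X : Fin n → Fin n → R} (h : Straightening X) (f : R →ₐ[ℂ] S) :
    Straightening fun i j => f (X i j) where
  skew i j a b h1 h2 := by
    obtain ⟨c, hc⟩ := h.skew i j a b h1 h2
    exact ⟨c, by rw [← map_mul, hc, map_smul, map_mul]⟩
  cross i j a b h1 h2 := by
    obtain ⟨c, d, hc⟩ := h.cross i j a b h1 h2
    exact ⟨c, d, by rw [← map_mul, hc, map_add, map_smul, map_smul, map_mul, map_mul]⟩

namespace Straightening

variable {n : ℕ} {M : Type*} [AddCommGroup M] [Module ℂ M] {X : Fin n → Fin n → Module.End ℂ M}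

theorem apply_skew (h : Straightening X) {i j a b : Fin n} (h1 : ¬ (i < a ∧ b < j))
    (h2 : ¬ (a < i ∧ j < b)) : ∃ c : ℂ, ∀ u, X i j (X a b u) = c • X a b (X i j u) := by
  obtain ⟨c, hc⟩ := h.skew i j a b h1 h2
  exact ⟨c, fun u => LinearMap.congr_fun hc u⟩

theorem apply_cross (h : Straightening X) {i j a b : Fin n} (h1 : a < i) (h2 : j < b) :
    ∃ c d : ℂ, ∀ u, X i j (X a b u) = c • X a b (X i j u) + d • X a j (X i b u) := by
  obtain ⟨c, d, hc⟩ := h.cross i j a b h1 h2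
  exact ⟨c, d, fun u => LinearMap.congr_fun hc u⟩

/-- Properties of the span of the ordered monomials in the rows with index at least `r`. -/
structure RowStable (X : Fin n → Fin n → Module.End ℂ M) (r : ℕ) (T : Submodule ℂ M) : Prop where
  -- Once the rows from `r` on are used, entries below the diagonal are only known to kill the span
  -- in columns before `r`.
  lower : ∀ i j : Fin n, j < i → (j : ℕ) < r → ∀ u ∈ T, X i j u = 0
  diag : ∀ i, ∀ u ∈ T, X i i u ∈ T
  stable : ∀ i j : Fin n, r ≤ i → r ≤ j → ∀ u ∈ T, X i j u ∈ T

/-- Moving `X i j` past `X r k` creates at worst a correction `X r j * X i k`, whose first factor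
lies again in row `r`. In `col` this factor is the diagonal entry `X r r`, which is why `main` must
precede it. -/
theorem RowStable.step (h : Straightening X) (r : Fin n) {T : Submodule ℂ M}
    (hT : RowStable X (r + 1) T) :
    RowStable X r (stableClosure {f | ∃ k, r < k ∧ f = X r k} T) := by
  set F : Set (Module.End ℂ M) := {f | ∃ k, r < k ∧ f = X r k} with hF
  set T' := stableClosure F T with hT'
  have hx : ∀ k, r < k → ∀ u ∈ T', X r k u ∈ T' := fun k hk u hu =>
    apply_mem_stableClosure (F := F) ⟨k, hk, rfl⟩ hu
  have lower : ∀ u ∈ T', ∀ i j : Fin n, j < i → j < r → X i j u = 0 := by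
    let P : Submodule ℂ M := ⨅ (i : Fin n) (j : Fin n) (_ : j < i) (_ : j < r), LinearMap.ker (X i j)
    have hP : ∀ u, u ∈ P ↔ ∀ i j : Fin n, j < i → j < r → X i j u = 0 := by
      simp [P, Submodule.mem_iInf]
    intro u hu
    rw [← hP]
    refine stableClosure_induction (p := P) ?_ ?_ hu
    · intro u hu
      rw [hP]
      exact fun i j hji hjr => hT.lower i j hji (Nat.lt_succ_of_lt hjr) u hu
    · rintro _ ⟨k, hk, rfl⟩ u _ hu
      rw [hP] at hu ⊢
      intro i j hji hjr
      by_cases hir : r < i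
      -- The factors of the correction `X r j * X i k` commute up to a scalar, so `X r j` may act
      -- first, and it kills `u`.
      · obtain ⟨c, d, hc⟩ := h.apply_cross hir (hjr.trans hk)
        obtain ⟨c', hc'⟩ := h.apply_skew (i := r) (j := j) (a := i) (b := k)
          (by simp [(hjr.trans hk).le]) (by simp [hir.le])
        rw [hc, hc', hu i j hji hjr, hu r j hjr hjr]
        simp
      · obtain ⟨c, hc⟩ := h.apply_skew (i := i) (j := j) (a := r) (b := k)
          (by simp [(hjr.trans hk).le]) (by simp [not_lt.1 hir])
        rw [hc, hu i j hji hjr]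
        simp
  have main : ∀ u ∈ T', (∀ i, X i i u ∈ T') ∧ ∀ i j : Fin n, r < i → r < j → X i j u ∈ T' := by
    let P : Submodule ℂ M := (⨅ i, T'.comap (X i i)) ⊓
      ⨅ (i : Fin n) (j : Fin n) (_ : r < i) (_ : r < j), T'.comap (X i j)
    have hP : ∀ u, u ∈ P ↔ (∀ i, X i i u ∈ T') ∧
        ∀ i j : Fin n, r < i → r < j → X i j u ∈ T' := by
      simp [P, Submodule.mem_iInf]
    intro u hu
    rw [← hP]
    refine stableClosure_induction (p := P) ?_ ?_ hu
    · intro u hu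
      rw [hP]
      exact ⟨fun i => le_stableClosure (hT.diag i u hu), fun i j hi hj =>
        le_stableClosure (hT.stable i j hi hj u hu)⟩
    · rintro _ ⟨k, hk, rfl⟩ u hu' hu
      rw [hP] at hu ⊢
      refine ⟨fun i => ?_, fun i j hi hj => ?_⟩
      · by_cases hc : r < i ∧ i < k
        · obtain ⟨c, d, e⟩ := h.apply_cross hc.1 hc.2
          rw [e]
          exact add_mem (Submodule.smul_mem _ _ (hx k hk _ (hu.1 i)))
            (Submodule.smul_mem _ _ (hx i hc.1 _ (hu.2 i k hc.1 hk)))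
        · obtain ⟨c, e⟩ := h.apply_skew (i := i) (j := i) (a := r) (b := k)
            (fun h' => absurd (h'.1.trans hk) (not_lt.2 h'.2.le)) hc
          rw [e]
          exact Submodule.smul_mem _ _ (hx k hk _ (hu.1 i))
      · by_cases hc : j < k
        · obtain ⟨c, d, e⟩ := h.apply_cross hi hc
          rw [e]
          exact add_mem (Submodule.smul_mem _ _ (hx k hk _ (hu.2 i j hi hj)))
            (Submodule.smul_mem _ _ (hx j hj _ (hu.2 i k hi hk)))
        · obtain ⟨c, e⟩ := h.apply_skew (i := i) (j := j) (a := r) (b := k)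
            (fun h' => absurd hi (not_lt.2 h'.1.le)) (fun h' => hc h'.2)
          rw [e]
          exact Submodule.smul_mem _ _ (hx k hk _ (hu.2 i j hi hj))
  have col : ∀ u ∈ T', ∀ i : Fin n, r < i → X i r u ∈ T' := by
    let P : Submodule ℂ M := ⨅ (i : Fin n) (_ : r < i), T'.comap (X i r)
    have hP : ∀ u, u ∈ P ↔ ∀ i : Fin n, r < i → X i r u ∈ T' := by
      simp [P, Submodule.mem_iInf]
    intro u hu
    rw [← hP]
    refine stableClosure_induction (p := P) ?_ ?_ hu
    · intro u hu
      rw [hP]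
      intro i hi
      rw [hT.lower i r hi (Nat.lt_succ_self _) u hu]
      exact zero_mem _
    · rintro _ ⟨k, hk, rfl⟩ u hu' hu
      rw [hP] at hu ⊢
      intro i hi
      obtain ⟨c, d, e⟩ := h.apply_cross hi hk
      rw [e]
      exact add_mem (Submodule.smul_mem _ _ (hx k hk _ (hu i hi)))
        (Submodule.smul_mem _ _ ((main _ ((main u hu').2 i k hi hk)).1 r))
  refine ⟨fun i j hji hjr u hu => lower u hu i j hji hjr, fun i u hu => (main u hu).1 i, ?_⟩
  intro i j hi hj u hu
  rcases (show r ≤ i from hi).eq_or_lt with rfl | hi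
  · rcases (show r ≤ j from hj).eq_or_lt with rfl | hj
    · exact (main u hu).1 _
    · exact hx j hj u hu
  · rcases (show r ≤ j from hj).eq_or_lt with rfl | hj
    · exact col u hu i hi
    · exact (main u hu).2 i j hi hj

/-- The subspace generated by a singular vector is spanned by ordered monomials in the upper
entries. -/
theorem exists_stable (h : Straightening X) (s : M) (hlow : ∀ i j, j < i → X i j s = 0)
    (hdiag : ∀ i, ∃ c : ℂ, X i i s = c • s) :
    ∃ T : Submodule ℂ M, s ∈ T ∧ (∀ i j, ∀ u ∈ T, X i j u ∈ T) ∧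
      -- `T` lies in the span of `s` and the images of the upper entries; functionals killing these
      -- images are thereby controlled on `T`.
      (∀ Q : Submodule ℂ M, s ∈ Q → (∀ i j, i < j → ∀ u, X i j u ∈ Q) → T ≤ Q) ∧
      ∀ e : ℕ, 0 < e → (∀ i j, i < j → X i j ^ e = 0) →
        FiniteDimensional ℂ T ∧ Module.finrank ℂ T ≤ e ^ (∑ i ∈ Finset.range n, i) := by
  suffices H : ∀ k, k ≤ n → ∃ T : Submodule ℂ M, s ∈ T ∧ RowStable X (n - k) T ∧
      (∀ Q : Submodule ℂ M, s ∈ Q → (∀ i j, i < j → ∀ u, X i j u ∈ Q) → T ≤ Q) ∧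
      ∀ e : ℕ, 0 < e → (∀ i j, i < j → X i j ^ e = 0) →
        FiniteDimensional ℂ T ∧ Module.finrank ℂ T ≤ e ^ (∑ i ∈ Finset.range k, i) by
    obtain ⟨T, h1, h2, h3⟩ := H n le_rfl
    exact ⟨T, h1, fun i j => h2.stable i j (by simp) (by simp), h3⟩
  intro k
  induction k with
  | zero =>
    refine fun _ => ⟨ℂ ∙ s, Submodule.mem_span_singleton_self s, ⟨?_, ?_, ?_⟩, ?_, ?_⟩
    · intro i j hji _ u hu
      obtain ⟨c, rfl⟩ := Submodule.mem_span_singleton.1 hu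
      rw [map_smul, hlow i j hji, smul_zero]
    · intro i u hu
      obtain ⟨c, rfl⟩ := Submodule.mem_span_singleton.1 hu
      obtain ⟨d, hd⟩ := hdiag i
      rw [map_smul, hd]
      exact Submodule.smul_mem _ _ (Submodule.smul_mem _ _ (Submodule.mem_span_singleton_self s))
    · intro i j hi
      have := i.2
      omega
    · intro Q hs _
      simpa using hs
    · intro e _ _
      exact ⟨inferInstance, by simpa using finrank_span_le_card (R := ℂ) ({s} : Set M)⟩
  | succ k ih =>
    intro hk
    obtain ⟨T, h1, h2, h3, h4⟩ := ih (by omega)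
    -- Rows are added from the bottom; this one has `k` entries above the diagonal, whence the
    -- exponent.
    let r : Fin n := ⟨n - (k + 1), by omega⟩
    have hr : (r : ℕ) + 1 = n - k := by simp only [r]; omega
    refine ⟨stableClosure {f | ∃ k, r < k ∧ f = X r k} T, le_stableClosure h1,
      RowStable.step h r (by rwa [hr]), ?_, ?_⟩
    · intro Q hs hQ
      refine stableClosure_le (h3 Q hs hQ) ?_
      rintro _ ⟨k, hk, rfl⟩ u _
      exact hQ r k hk u
    · intro e hpos he
      classical
      obtain ⟨h5, h6⟩ := h4 e hpos he
      have hF : {f | ∃ k, r < k ∧ f = X r k} =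
          (((Finset.Ioi r).image (X r) : Finset (Module.End ℂ M)) : Set (Module.End ℂ M)) := by
        ext f
        simp [eq_comm]
      rw [hF]
      obtain ⟨h7, h8⟩ := finrank_stableClosure_le (e := e) ((Finset.Ioi r).image (X r)) (by
          intro x hx y hy
          obtain ⟨a, _, rfl⟩ := Finset.mem_image.1 hx
          obtain ⟨b, _, rfl⟩ := Finset.mem_image.1 hy
          exact h.skew r a r b (by simp) (by simp)) (by
          intro x hx
          obtain ⟨a, ha, rfl⟩ := Finset.mem_image.1 hx
          exact he r a (Finset.mem_Ioi.1 ha)) T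
      refine ⟨h7, h8.trans ?_⟩
      rw [Finset.sum_range_succ, add_comm, pow_add]
      refine Nat.mul_le_mul (Nat.pow_le_pow_right hpos ?_) h6
      refine Finset.card_image_le.trans ?_
      rw [Fin.card_Ioi]
      simp only [r]
      omega

end Straightening

/-! ### Quantum matrices and their products -/

/-- The relations of the standard quantized matrix algebra, for a matrix indexed by `ℕ`. -/
structure QuantumMatrix {R : Type*} [Ring R] [Algebra ℂ R] (q : ℂ) (Y : ℕ → ℕ → R) : Prop where
  row : ∀ i j k, j < k → Y i j * Y i k = q • (Y i k * Y i j)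
  col : ∀ i j k, i < k → Y i j * Y k j = q • (Y k j * Y i j)
  anti : ∀ i j s t, i < s → t < j → Y i j * Y s t = Y s t * Y i j
  diag : ∀ i j s t, i < s → j < t →
    Y i j * Y s t = Y s t * Y i j + (q - q⁻¹) • (Y i t * Y s j)

theorem QuantumMatrix.map {R S : Type*} [Ring R] [Algebra ℂ R] [Ring S] [Algebra ℂ S] {q : ℂ}
    {Y : ℕ → ℕ → R} (h : QuantumMatrix q Y) (f : R → S) (hmul : ∀ x y, f (x * y) = f x * f y)
    (hadd : ∀ x y, f (x + y) = f x + f y) (hsmul : ∀ (c : ℂ) x, f (c • x) = c • f x) :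
    QuantumMatrix q fun i j => f (Y i j) where
  row i j k hjk := by rw [← hmul, h.row i j k hjk, hsmul, hmul]
  col i j k hik := by rw [← hmul, h.col i j k hik, hsmul, hmul]
  anti i j s t h1 h2 := by rw [← hmul, h.anti i j s t h1 h2, hmul]
  diag i j s t h1 h2 := by
    rw [← hmul, h.diag i j s t h1 h2, hadd, hsmul, hmul, hmul]

/-- Right multiplication of a matrix by the block `(a, b; b, d)` in the columns `l`, `l + 1`. -/
def blockColumns {R : Type*} [Ring R] (Y : ℕ → ℕ → R) (l : ℕ) (a b d : R) (i j : ℕ) : R :=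
  if j = l then Y i l * a + Y i (l + 1) * b
  else if j = l + 1 then Y i l * b + Y i (l + 1) * d
  else Y i j

section BlockColumns

variable {R : Type*} [Ring R] {Y : ℕ → ℕ → R} {l : ℕ} {a b d : R}

theorem blockColumns_left (i : ℕ) :
    blockColumns Y l a b d i l = Y i l * a + Y i (l + 1) * b := by
  simp [blockColumns]

theorem blockColumns_right (i : ℕ) :
    blockColumns Y l a b d i (l + 1) = Y i l * b + Y i (l + 1) * d := by
  simp [blockColumns]

theorem blockColumns_of_ne {i j : ℕ} (h1 : j ≠ l) (h2 : j ≠ l + 1) :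
    blockColumns Y l a b d i j = Y i j := by
  simp [blockColumns, h1, h2]

/-- This is the coproduct: a product of two quantum matrices whose entries commute with each other
is again one. The second factor is the identity outside a `2 × 2` quantum block with equal
off-diagonal entries. -/
theorem QuantumMatrix.blockColumns [Algebra ℂ R] {q : ℂ} (hq : q ≠ 0) (h : QuantumMatrix q Y)
    (hab : a * b = q • (b * a)) (hbd : b * d = q • (d * b))
    (had : a * d = d * a + (q - q⁻¹) • (b * b))
    (ha : ∀ i j, Commute a (Y i j)) (hb : ∀ i j, Commute b (Y i j))
    (hd : ∀ i j, Commute d (Y i j)) : QuantumMatrix q (blockColumns Y l a b d) := by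
  -- Relations with an entry outside the two block columns are linear in these columns.
  have lin : ∀ (u y y' x x' : R) (c : ℂ), Commute x u → Commute x' u →
      u * y = c • (y * u) → u * y' = c • (y' * u) →
      u * (y * x + y' * x') = c • ((y * x + y' * x') * u) := by
    intro u y y' x x' c h1 h2 h3 h4
    rw [mul_add, ← mul_assoc, ← mul_assoc, h3, h4, add_mul, mul_assoc y, mul_assoc y', h1.eq,
      h2.eq, smul_add, smul_mul_assoc, smul_mul_assoc, mul_assoc, mul_assoc]
  have lin' : ∀ (u y y' x x' : R) (c : ℂ), Commute x u → Commute x' u →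
      y * u = c • (u * y) → y' * u = c • (u * y') →
      (y * x + y' * x') * u = c • (u * (y * x + y' * x')) := by
    intro u y y' x x' c h1 h2 h3 h4
    rw [mul_add, ← mul_assoc, ← mul_assoc, add_mul, mul_assoc y, mul_assoc y', h1.eq,
      h2.eq, smul_add, ← mul_assoc, ← mul_assoc, h3, h4, smul_mul_assoc, smul_mul_assoc]
  have hl : l < l + 1 := Nat.lt_succ_self l
  have col_cases : ∀ j, j = l ∨ j = l + 1 ∨ (j ≠ l ∧ j ≠ l + 1) := by omega
  have aa := fun i j => (ha i j).mul_mul_mul_comm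
  have bb := fun i j => (hb i j).mul_mul_mul_comm
  have dd := fun i j => (hd i j).mul_mul_mul_comm
  refine ⟨?_, ?_, ?_, ?_⟩
  · intro i j k hjk
    rcases col_cases j with rfl | rfl | ⟨j1, j2⟩ <;> rcases col_cases k with rfl | rfl | ⟨k1, k2⟩ <;>
      try omega
    · rw [blockColumns_left, blockColumns_right]
      simp only [add_mul, mul_add, aa, bb, dd, h.row i _ _ hl, hab, hbd, had]
      simp only [smul_mul_assoc, mul_smul_comm, smul_add, smul_smul]
      match_scalars <;> field_simp <;> ring
    · rw [blockColumns_left, blockColumns_of_ne k1 k2]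
      exact lin' _ _ _ _ _ _ (ha _ _) (hb _ _) (h.row _ _ _ hjk) (h.row _ _ _ (by omega))
    · rw [blockColumns_right, blockColumns_of_ne k1 k2]
      exact lin' _ _ _ _ _ _ (hb _ _) (hd _ _) (h.row _ _ _ (by omega)) (h.row _ _ _ (by omega))
    · rw [blockColumns_left, blockColumns_of_ne j1 j2]
      exact lin _ _ _ _ _ _ (ha _ _) (hb _ _) (h.row _ _ _ hjk) (h.row _ _ _ (by omega))
    · rw [blockColumns_right, blockColumns_of_ne j1 j2]
      exact lin _ _ _ _ _ _ (hb _ _) (hd _ _) (h.row _ _ _ (by omega)) (h.row _ _ _ (by omega))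
    · rw [blockColumns_of_ne j1 j2, blockColumns_of_ne k1 k2]
      exact h.row _ _ _ hjk
  · intro i j s his
    rcases col_cases j with rfl | rfl | ⟨j1, j2⟩
    · rw [blockColumns_left, blockColumns_left]
      simp only [add_mul, mul_add, aa, bb, h.col _ _ _ his, h.diag _ _ _ _ his hl,
        h.anti _ _ _ _ his hl, hab]
      simp only [smul_mul_assoc, mul_smul_comm, smul_add, smul_smul]
      match_scalars <;> field_simp <;> ring
    · rw [blockColumns_right, blockColumns_right]
      simp only [add_mul, mul_add, bb, dd, h.col _ _ _ his, h.diag _ _ _ _ his hl,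
        h.anti _ _ _ _ his hl, hbd]
      simp only [smul_mul_assoc, mul_smul_comm, smul_add, smul_smul]
      match_scalars <;> field_simp <;> ring
    · rw [blockColumns_of_ne j1 j2, blockColumns_of_ne j1 j2]
      exact h.col _ _ _ his
  · intro i j s t his htj
    rcases col_cases j with rfl | rfl | ⟨j1, j2⟩ <;> rcases col_cases t with rfl | rfl | ⟨t1, t2⟩ <;>
      try omega
    · rw [blockColumns_left, blockColumns_of_ne t1 t2]
      simpa using lin' _ _ _ _ _ 1 (ha _ _) (hb _ _)
        (by simpa using h.anti _ _ _ _ his htj)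
        (by simpa using h.anti i (j + 1) s t his (by omega))
    · rw [blockColumns_right, blockColumns_left]
      simp only [add_mul, mul_add, aa, bb, dd, h.col _ _ _ his, h.diag _ _ _ _ his hl,
        h.anti _ _ _ _ his hl, hbd, hab, had]
      simp only [smul_mul_assoc, mul_smul_comm]
      match_scalars <;> field_simp
    · rw [blockColumns_right, blockColumns_of_ne t1 t2]
      simpa using lin' _ _ _ _ _ 1 (hb _ _) (hd _ _)
        (by simpa using h.anti i l s t his (by omega))
        (by simpa using h.anti i (l + 1) s t his (by omega))
    · rw [blockColumns_left, blockColumns_of_ne j1 j2]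
      simpa using lin _ _ _ _ _ 1 (ha _ _) (hb _ _)
        (by simpa using h.anti i j s t his (by omega))
        (by simpa using h.anti i j s (t + 1) his (by omega))
    · rw [blockColumns_right, blockColumns_of_ne j1 j2]
      simpa using lin _ _ _ _ _ 1 (hb _ _) (hd _ _)
        (by simpa using h.anti i j s l his (by omega))
        (by simpa using h.anti i j s (l + 1) his (by omega))
    · rw [blockColumns_of_ne j1 j2, blockColumns_of_ne t1 t2]
      exact h.anti _ _ _ _ his htj
  · intro i j s t his hjt
    have e1 : ∀ u y y' w z z' x x' : R, Commute x u → Commute x' u → Commute x w →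
        Commute x' w → u * y = y * u + (q - q⁻¹) • (z * w) →
        u * y' = y' * u + (q - q⁻¹) • (z' * w) →
        u * (y * x + y' * x') = (y * x + y' * x') * u + (q - q⁻¹) • ((z * x + z' * x') * w) := by
      intro u y y' w z z' x x' h1 h2 h3 h4 h5 h6
      rw [mul_add, ← mul_assoc, ← mul_assoc, h5, h6]
      simp only [add_mul, mul_assoc, smul_mul_assoc, h1.eq, h2.eq, h3.eq, h4.eq, smul_add]
      abel
    have e2 : ∀ u y y' w z z' x x' : R, Commute x u → Commute x' u → Commute x w →
        Commute x' w → y * u = u * y + (q - q⁻¹) • (w * z) →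
        y' * u = u * y' + (q - q⁻¹) • (w * z') →
        (y * x + y' * x') * u = u * (y * x + y' * x') + (q - q⁻¹) • (w * (z * x + z' * x')) := by
      intro u y y' w z z' x x' h1 h2 h3 h4 h5 h6
      rw [add_mul, mul_assoc y, mul_assoc y', h1.eq, h2.eq, ← mul_assoc, ← mul_assoc, h5, h6]
      simp only [add_mul, mul_add, mul_assoc, smul_mul_assoc, smul_add]
      abel
    rcases col_cases j with rfl | rfl | ⟨j1, j2⟩ <;> rcases col_cases t with rfl | rfl | ⟨t1, t2⟩ <;>
      try omega
    · rw [blockColumns_left, blockColumns_right, blockColumns_left, blockColumns_right]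
      simp only [add_mul, mul_add, aa, bb, dd, h.col _ _ _ his, h.diag _ _ _ _ his hl,
        h.anti _ _ _ _ his hl, hbd, hab, had]
      simp only [smul_mul_assoc, mul_smul_comm, smul_add, smul_smul]
      match_scalars <;> field_simp <;> ring
    · rw [blockColumns_left, blockColumns_left, blockColumns_of_ne t1 t2, blockColumns_of_ne t1 t2]
      exact e2 _ _ _ _ _ _ _ _ (ha _ _) (hb _ _) (ha _ _) (hb _ _) (h.diag _ _ _ _ his hjt)
        (h.diag _ _ _ _ his (by omega))
    · rw [blockColumns_right, blockColumns_right, blockColumns_of_ne t1 t2,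
        blockColumns_of_ne t1 t2]
      exact e2 _ _ _ _ _ _ _ _ (hb _ _) (hd _ _) (hb _ _) (hd _ _)
        (h.diag _ _ _ _ his (by omega)) (h.diag _ _ _ _ his (by omega))
    · rw [blockColumns_left, blockColumns_left, blockColumns_of_ne j1 j2, blockColumns_of_ne j1 j2]
      exact e1 _ _ _ _ _ _ _ _ (ha _ _) (hb _ _) (ha _ _) (hb _ _) (h.diag _ _ _ _ his hjt)
        (h.diag _ _ _ _ his (by omega))
    · rw [blockColumns_right, blockColumns_right, blockColumns_of_ne j1 j2,
        blockColumns_of_ne j1 j2]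
      exact e1 _ _ _ _ _ _ _ _ (hb _ _) (hd _ _) (hb _ _) (hd _ _)
        (h.diag _ _ _ _ his (by omega)) (h.diag _ _ _ _ his (by omega))
    · rw [blockColumns_of_ne j1 j2, blockColumns_of_ne t1 t2, blockColumns_of_ne j1 j2,
        blockColumns_of_ne t1 t2]
      exact h.diag _ _ _ _ his hjt

end BlockColumns

/-! ### A truncated `q`-oscillator -/

section Oscillator

variable {U : Type*} [AddCommGroup U] [Module ℂ U] {e : ℕ}

/-- The raising operator. -/
def oscRaise (e : ℕ) (U : Type*) [AddCommGroup U] [Module ℂ U] :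
    Module.End ℂ (Fin (e + 1) → U) where
  toFun g := Fin.cases 0 fun p : Fin e => g p.castSucc
  map_add' f g := by
    funext p
    refine Fin.cases ?_ (fun p => ?_) p <;> simp
  map_smul' c g := by
    funext p
    refine Fin.cases ?_ (fun p => ?_) p <;> simp

/-- The number operator `q ^ (-p)`. -/
noncomputable def oscScale (q : ℂ) (e : ℕ) (U : Type*) [AddCommGroup U] [Module ℂ U] :
    Module.End ℂ (Fin (e + 1) → U) where
  toFun g p := (q ^ (p : ℕ))⁻¹ • g p
  map_add' f g := by
    funext p
    simp
  map_smul' c g := by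
    funext p
    simp [smul_smul, mul_comm]

/-- The matrix coefficients of the lowering operator. -/
noncomputable def oscCoeff (q : ℂ) (p : ℕ) : ℂ := q * ((q ^ (2 * p))⁻¹ - 1)

/-- The lowering operator. -/
noncomputable def oscLower (q : ℂ) (e : ℕ) (U : Type*) [AddCommGroup U] [Module ℂ U] :
    Module.End ℂ (Fin (e + 1) → U) where
  toFun g := Fin.lastCases 0 fun p : Fin e => oscCoeff q (p + 1) • g p.succ
  map_add' f g := by
    funext p
    refine Fin.lastCases ?_ (fun p => ?_) p <;> simp
  map_smul' c g := by
    funext p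
    refine Fin.lastCases ?_ (fun p => ?_) p <;> simp [smul_smul, mul_comm]

@[simp] theorem oscRaise_zero (g : Fin (e + 1) → U) : oscRaise e U g 0 = 0 := rfl

@[simp] theorem oscRaise_succ (g : Fin (e + 1) → U) (p : Fin e) :
    oscRaise e U g p.succ = g p.castSucc := rfl

@[simp] theorem oscScale_apply (q : ℂ) (g : Fin (e + 1) → U) (p : Fin (e + 1)) :
    oscScale q e U g p = (q ^ (p : ℕ))⁻¹ • g p := rfl

@[simp] theorem oscLower_last (q : ℂ) (g : Fin (e + 1) → U) :
    oscLower q e U g (Fin.last e) = 0 := by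
  simp [oscLower]

@[simp] theorem oscLower_castSucc (q : ℂ) (g : Fin (e + 1) → U) (p : Fin e) :
    oscLower q e U g p.castSucc = oscCoeff q (p + 1) • g p.succ := by
  simp [oscLower]

theorem oscRaise_mul_oscScale {q : ℂ} (hq : q ≠ 0) :
    oscRaise e U * oscScale q e U = q • (oscScale q e U * oscRaise e U) := by
  refine LinearMap.ext fun g => funext fun p => ?_
  refine Fin.cases ?_ (fun p => ?_) p
  · simp
  · simp only [Module.End.mul_apply, oscRaise_succ, oscScale_apply, Fin.val_castSucc,
      LinearMap.smul_apply, Pi.smul_apply, Fin.val_succ, smul_smul, pow_succ]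
    congr 1
    field_simp

theorem oscScale_mul_oscLower {q : ℂ} (hq : q ≠ 0) :
    oscScale q e U * oscLower q e U = q • (oscLower q e U * oscScale q e U) := by
  refine LinearMap.ext fun g => funext fun p => ?_
  refine Fin.lastCases ?_ (fun p => ?_) p
  · simp
  · simp only [Module.End.mul_apply, oscLower_castSucc, oscScale_apply, Fin.val_castSucc,
      LinearMap.smul_apply, Pi.smul_apply, Fin.val_succ, smul_smul, pow_succ]
    congr 1
    field_simp

theorem oscRaise_oscLower_apply (q : ℂ) (g : Fin (e + 1) → U) (p : Fin (e + 1)) :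
    oscRaise e U (oscLower q e U g) p = oscCoeff q p • g p := by
  refine Fin.cases ?_ (fun p => ?_) p <;> simp [oscCoeff]

theorem oscLower_oscRaise_apply {q : ℂ} (hq : q ^ (2 * (e + 1)) = 1) (g : Fin (e + 1) → U)
    (p : Fin (e + 1)) :
    oscLower q e U (oscRaise e U g) p = oscCoeff q (p + 1) • g p := by
  refine Fin.lastCases ?_ (fun p => ?_) p
  -- At the top level truncation makes the left side zero; the right side agrees because `oscCoeff q
  -- (e + 1)` vanishes.
  · simp [oscCoeff, hq]
  · simp

theorem oscRaise_mul_oscLower {q : ℂ} (hq0 : q ≠ 0) (hq : q ^ (2 * (e + 1)) = 1) :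
    oscRaise e U * oscLower q e U = oscLower q e U * oscRaise e U +
      (q - q⁻¹) • (oscScale q e U * oscScale q e U) := by
  refine LinearMap.ext fun g => funext fun p => ?_
  simp only [Module.End.mul_apply, LinearMap.add_apply, LinearMap.smul_apply, Pi.add_apply,
    Pi.smul_apply, oscRaise_oscLower_apply, oscLower_oscRaise_apply hq, oscScale_apply, smul_smul,
    ← add_smul]
  congr 1
  simp only [oscCoeff, mul_add, pow_add, mul_one, mul_comm 2 (p : ℕ), pow_mul]
  field_simp
  ring

theorem oscRaise_pow : oscRaise e U ^ (e + 1) = 0 := by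
  have key : ∀ (k : ℕ) (g : Fin (e + 1) → U) (p : Fin (e + 1)), (p : ℕ) < k →
      (oscRaise e U ^ k) g p = 0 := by
    intro k
    induction k with
    | zero => intro g p hp; omega
    | succ k ih =>
      intro g p
      rw [pow_succ', Module.End.mul_apply]
      refine Fin.cases ?_ (fun p => ?_) p
      · simp
      · intro hp
        rw [oscRaise_succ]
        exact ih _ _ (by simpa using hp)
  exact LinearMap.ext fun g => funext fun p => key _ g p p.2

theorem oscScale_injective {q : ℂ} (hq : q ≠ 0) : Function.Injective (oscScale q e U) := by
  intro f g h
  funext p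
  have := congr_fun h p
  simpa [hq] using this

theorem oscScale_surjective {q : ℂ} (hq : q ≠ 0) : Function.Surjective (oscScale q e U) := by
  intro g
  refine ⟨fun p => q ^ (p : ℕ) • g p, funext fun p => ?_⟩
  simp [smul_smul, hq]

/-- The coefficients `oscCoeff q p` with `0 < p ≤ e` are nonzero, so only the vacuum level `p = 0`
is killed. -/
theorem eq_zero_of_oscLower_eq_zero {q : ℂ} (hq0 : q ≠ 0)
    (hq : ∀ p, 0 < p → p < e + 1 → q ^ (2 * p) ≠ 1) {g : Fin (e + 1) → U}
    (h : oscLower q e U g = 0) (p : Fin e) : g p.succ = 0 := by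
  have h1 := congr_fun h p.castSucc
  rw [oscLower_castSucc, Pi.zero_apply, smul_eq_zero] at h1
  refine h1.resolve_left ?_
  refine mul_ne_zero hq0 (sub_ne_zero.2 fun h2 => hq (p + 1) (Nat.succ_pos _) (by omega)
    (inv_eq_one.1 h2))

/-- The block of the oscillator is injective as a matrix of operators. -/
theorem oscBlock_injective {q : ℂ} (hq0 : q ≠ 0) (hq : q ^ (2 * (e + 1)) = 1)
    {f g : Fin (e + 1) → U} (h1 : oscRaise e U f + oscScale q e U g = 0)
    (h2 : oscScale q e U f + oscLower q e U g = 0) : f = 0 ∧ g = 0 := by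
  have hf : f = 0 := by
    have h3 : oscLower q e U (oscRaise e U f) + oscLower q e U (oscScale q e U g) = 0 := by
      rw [← map_add, h1, map_zero]
    have h4 : oscScale q e U (oscScale q e U f) + oscScale q e U (oscLower q e U g) = 0 := by
      rw [← map_add, h2, map_zero]
    have h5 := LinearMap.congr_fun (oscScale_mul_oscLower (U := U) (e := e) hq0) g
    simp only [Module.End.mul_apply, LinearMap.smul_apply] at h5
    rw [h5] at h4
    funext p
    have h6 := congr_fun h3 p
    have h7 := congr_fun h4 p
    simp only [Pi.add_apply, oscLower_oscRaise_apply hq, Pi.smul_apply, oscScale_apply,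
      smul_smul, Pi.zero_apply] at h6 h7
    have h8 : (q * oscCoeff q (p + 1) - (q ^ (p : ℕ))⁻¹ * (q ^ (p : ℕ))⁻¹) • f p = 0 := by
      have : q • (oscCoeff q (p + 1) • f p + oscLower q e U (oscScale q e U g) p) -
          (((q ^ (p : ℕ))⁻¹ * (q ^ (p : ℕ))⁻¹) • f p + q • oscLower q e U (oscScale q e U g) p)
          = 0 := by
        rw [h6, h7, smul_zero, sub_zero]
      rw [← this]
      module
    refine (smul_eq_zero.1 h8).resolve_left ?_
    -- This is `q` times the quantum determinant `da - q⁻¹b²` of the block, which is the scalar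
    -- `-q`.
    have : q * oscCoeff q (p + 1) - (q ^ (p : ℕ))⁻¹ * (q ^ (p : ℕ))⁻¹ = -q ^ 2 := by
      simp only [oscCoeff, mul_add, pow_add, mul_one, mul_comm 2 (p : ℕ), pow_mul]
      field_simp
      ring
    rw [this]
    simp [hq0]
  refine ⟨hf, ?_⟩
  rw [hf, map_zero, zero_add] at h1
  exact oscScale_injective hq0 (by rw [h1, map_zero])

end Oscillator

section OscillatorSingle

variable {U : Type*} [AddCommGroup U] [Module ℂ U] {e : ℕ}

theorem compLeft_single (f : Module.End ℂ U) (p : Fin (e + 1)) (x : U) :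
    f.compLeft (Fin (e + 1)) (Pi.single p x) = Pi.single p (f x) := by
  funext r
  rcases eq_or_ne r p with rfl | h
  · simp
  · simp [Pi.single_eq_of_ne h]

theorem oscRaise_single_castSucc (p : Fin e) (x : U) :
    oscRaise e U (Pi.single p.castSucc x) = Pi.single p.succ x := by
  funext r
  refine Fin.cases ?_ (fun r => ?_) r
  · rw [oscRaise_zero, Pi.single_eq_of_ne (Fin.succ_ne_zero p).symm]
  · rw [oscRaise_succ]
    rcases eq_or_ne r p with rfl | h
    · simp
    · rw [Pi.single_eq_of_ne (by simpa using h), Pi.single_eq_of_ne (by simpa using h)]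

theorem oscScale_single_zero (q : ℂ) (x : U) :
    oscScale q e U (Pi.single 0 x) = Pi.single 0 x := by
  funext r
  rcases eq_or_ne r 0 with rfl | h
  · simp
  · simp [Pi.single_eq_of_ne h]

theorem oscLower_single_zero (q : ℂ) (x : U) : oscLower q e U (Pi.single 0 x) = 0 := by
  funext r
  refine Fin.lastCases ?_ (fun r => ?_) r
  · simp
  · rw [oscLower_castSucc, Pi.single_eq_of_ne (Fin.succ_ne_zero r)]
    simp

end OscillatorSingle

/-! ### Fock modules, built by adding oscillators -/

/-- The block matrix `1 ⊕ Z`. -/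
def shiftMatrix {R : Type*} [Ring R] (Z : ℕ → ℕ → R) : ℕ → ℕ → R
  | 0, 0 => 1
  | 0, _ + 1 => 0
  | _ + 1, 0 => 0
  | i + 1, j + 1 => Z i j

theorem QuantumMatrix.shiftMatrix {R : Type*} [Ring R] [Algebra ℂ R] {q : ℂ} {Z : ℕ → ℕ → R}
    (h : QuantumMatrix q Z) : QuantumMatrix q (shiftMatrix Z) where
  row i j k hjk := by
    obtain ⟨k, rfl⟩ : ∃ k', k = k' + 1 := ⟨k - 1, by omega⟩
    rcases i with _ | i <;> rcases j with _ | j <;> simp [_root_.shiftMatrix]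
    exact h.row _ _ _ (by omega)
  col i j k hik := by
    obtain ⟨k, rfl⟩ : ∃ k', k = k' + 1 := ⟨k - 1, by omega⟩
    rcases i with _ | i <;> rcases j with _ | j <;> simp [_root_.shiftMatrix]
    exact h.col _ _ _ (by omega)
  anti i j s t his htj := by
    obtain ⟨s, rfl⟩ : ∃ k', s = k' + 1 := ⟨s - 1, by omega⟩
    obtain ⟨j, rfl⟩ : ∃ k', j = k' + 1 := ⟨j - 1, by omega⟩
    rcases i with _ | i <;> rcases t with _ | t <;> simp [_root_.shiftMatrix]
    exact h.anti _ _ _ _ (by omega) (by omega)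
  diag i j s t his hjt := by
    obtain ⟨s, rfl⟩ : ∃ k', s = k' + 1 := ⟨s - 1, by omega⟩
    obtain ⟨t, rfl⟩ : ∃ k', t = k' + 1 := ⟨t - 1, by omega⟩
    rcases i with _ | i <;> rcases j with _ | j <;> simp [_root_.shiftMatrix]
    exact h.diag _ _ _ _ (by omega) (by omega)

/-- A module over the quantized matrix algebra which is generated by a highest weight vector with
all antidiagonal eigenvalues equal to `1`, together with the structure used to analyse its
submodules. The only relevant entries are those with indices below `n`. -/
structure FockModule (q : ℂ) (e n : ℕ) where
  V : Type
  [addCommGroup : AddCommGroup V]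
  [module : Module ℂ V]
  Z : ℕ → ℕ → Module.End ℂ V
  v : V
  rel : QuantumMatrix q Z
  -- Injectivity of the matrix on columns of vectors; `sing` of the initial stage rests on it.
  inj : ∀ w : ℕ → V, (∀ i < n, ∑ j ∈ Finset.range n, Z i j (w j) = 0) → ∀ j < n, w j = 0
  lower : ∀ i < n, ∀ j < n, n ≤ i + j → Z i j v = 0
  diag : ∀ i j, i + j + 1 = n → Z i j v = v
  upper_pow : ∀ i j, i + j + 1 < n → (Z i j ^ (e + 1)) v = 0
  upper_ne : ∀ i j, i + j + 1 < n → Z i j v ≠ 0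
  cyclic : ∀ p : Submodule ℂ V, v ∈ p → (∀ i < n, ∀ j < n, ∀ u ∈ p, Z i j u ∈ p) → p = ⊤
  finite : FiniteDimensional ℂ V
  finrank : Module.finrank ℂ V = (e + 1) ^ (∑ i ∈ Finset.range n, i)
  sing : ∀ u, (∀ i < n, ∀ j < n, n ≤ i + j → Z i j u = 0) → ∃ c : ℂ, u = c • v
  -- A degree filtration in which `Z i j` has degree `n - 1 - i - j`. Entries beyond the
  -- antidiagonal strictly lower it, which makes singular vectors exist.
  fil : ℤ → Submodule ℂ V
  fil_mono : Monotone fil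
  fil_neg : ∀ k < 0, fil k = ⊥
  fil_top : ∃ k, fil k = ⊤
  fil_apply : ∀ i < n, ∀ j < n, ∀ k, ∀ u ∈ fil k, Z i j u ∈ fil (k + (n - 1 - i - j))
  -- The coefficient of `v` modulo the images of the entries before the antidiagonal.
  φ : V →ₗ[ℂ] ℂ
  φ_v : φ v = 1
  φ_upper : ∀ i j, i + j + 1 < n → ∀ u, φ (Z i j u) = 0

attribute [instance] FockModule.addCommGroup FockModule.module

/-- An intermediate stage between a Fock module for `n` and one for `n + 1`, in which `l`
oscillators have been added. -/
structure FockStage {q : ℂ} {e n : ℕ} (H : FockModule q e n) (l : ℕ) where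
  U : Type
  [addCommGroup : AddCommGroup U]
  [module : Module ℂ U]
  -- The extra row has index `0` and the extra column index `l`. On the image of `ι`, columns before
  -- `l` act as those of `H`, and columns after it as those of `H` shifted by one. Each stage moves
  -- the extra column one place to the right.
  Y : ℕ → ℕ → Module.End ℂ U
  ι : H.V →ₗ[ℂ] U
  rel : QuantumMatrix q Y
  inj : ∀ w : ℕ → U, (∀ i < n + 1, ∑ j ∈ Finset.range (n + 1), Y i j (w j) = 0) →
    ∀ j < n + 1, w j = 0
  row_zero : ∀ j, l < j → Y 0 j = 0
  row_bij : Function.Bijective (Y 0 l)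
  row_ι : ∀ u, Y 0 l (ι u) = ι u
  row_pow : ∀ j < l, Y 0 j ^ (e + 1) = 0
  row_ne : ∀ j < l, ∀ u, u ≠ 0 → Y 0 j (ι u) ≠ 0
  ι_inj : Function.Injective ι
  left : ∀ s j, j < l → ∀ u, Y (s + 1) j (ι u) = ι (H.Z s j u)
  mid : ∀ s u, Y (s + 1) l (ι u) = 0
  right : ∀ s j, l ≤ j → ∀ u, Y (s + 1) (j + 1) (ι u) = ι (H.Z s j u)
  cyclic : ∀ p : Submodule ℂ U, (∀ u, ι u ∈ p) → (∀ j < l, ∀ x ∈ p, Y 0 j x ∈ p) → p = ⊤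
  finite : FiniteDimensional ℂ U
  finrank : Module.finrank ℂ U = (e + 1) ^ l * Module.finrank ℂ H.V
  -- The auxiliary vectors `w j` stand for columns not yet mixed with the extra one and make the
  -- induction on `l` work; for `l = n` the sum is empty.
  sing : ∀ (x : U) (w : ℕ → U),
    (∀ s < n, Y (s + 1) l x + ∑ j ∈ Finset.Ico l n, Y (s + 1) (j + 1) (w j) = 0) →
    (∃ u, ι u = x) ∧ ∀ j, l ≤ j → j < n → w j = 0
  fil : ℤ → Submodule ℂ U
  fil_mono : Monotone fil
  fil_neg : ∀ k < 0, fil k = ⊥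
  fil_top : ∃ k, fil k = ⊤
  -- Degrees refer to final positions: the extra column counts as column `n`, and column `j + 1` to
  -- its right as column `j`.
  fil_left : ∀ i ≤ n, ∀ j < l, ∀ k, ∀ u ∈ fil k, Y i j u ∈ fil (k + (n - i - j))
  fil_mid : ∀ i ≤ n, ∀ k, ∀ u ∈ fil k, Y i l u ∈ fil (k - i)
  fil_right : ∀ i ≤ n, ∀ j, l ≤ j → j < n → ∀ k, ∀ u ∈ fil k,
    Y i (j + 1) u ∈ fil (k + (n - i - j))
  φ : U →ₗ[ℂ] ℂ
  φ_ι : ∀ u, φ (ι u) = H.φ u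
  φ_row : ∀ j < l, ∀ x, φ (Y 0 j x) = 0
  φ_left : ∀ s j, j < l → s + j + 1 < n → ∀ x, φ (Y (s + 1) j x) = 0
  φ_right : ∀ s j, l ≤ j → s + j + 1 < n → ∀ x, φ (Y (s + 1) (j + 1) x) = 0

attribute [instance] FockStage.addCommGroup FockStage.module

/-- The Fock module for `n = 0`. -/
def fockModuleZero (q : ℂ) (e : ℕ) : FockModule q e 0 where
  V := ℂ
  Z i j := if i = j then 1 else 0
  v := 1
  rel := by
    refine ⟨?_, ?_, ?_, ?_⟩
    · intro i j k h
      split_ifs <;> first | omega | simp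
    · intro i j k h
      split_ifs <;> first | omega | simp
    · intro i j s t h1 h2
      split_ifs <;> first | omega | simp
    · intro i j s t h1 h2
      split_ifs <;> first | omega | simp
  inj := by simp
  lower := by simp
  diag := by simp
  upper_pow := by simp
  upper_ne := by simp
  cyclic p hv _ := by
    rw [eq_top_iff]
    intro x _
    simpa using p.smul_mem x hv
  finite := inferInstance
  finrank := by simp
  sing u _ := ⟨u, by simp⟩
  fil k := if 0 ≤ k then ⊤ else ⊥
  fil_mono := by
    intro a b h
    dsimp only
    split_ifs <;> first | omega | simp
  fil_neg k hk := by simp [not_le.2 hk]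
  fil_top := ⟨0, by simp⟩
  fil_apply := by simp
  φ := LinearMap.id
  φ_v := rfl
  φ_upper := by simp

/-- The initial stage. -/
def fockStageZero {q : ℂ} {e n : ℕ} (H : FockModule q e n) : FockStage H 0 where
  U := H.V
  Y := shiftMatrix H.Z
  ι := LinearMap.id
  rel := H.rel.shiftMatrix
  inj w hw := by
    have h0 : w 0 = 0 := by
      have := hw 0 (Nat.succ_pos n)
      rw [Finset.sum_range_succ'] at this
      simpa [shiftMatrix] using this
    have h1 := H.inj (fun j => w (j + 1)) (by
      intro i hi
      have := hw (i + 1) (by omega)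
      rw [Finset.sum_range_succ'] at this
      simpa [shiftMatrix] using this)
    intro j hj
    rcases j with _ | j
    · exact h0
    · exact h1 j (by omega)
  row_zero j hj := by
    obtain ⟨k, rfl⟩ : ∃ k', j = k' + 1 := ⟨j - 1, by omega⟩
    rfl
  row_bij := Function.bijective_id
  row_ι u := rfl
  row_pow j hj := absurd hj (Nat.not_lt_zero j)
  row_ne j hj := absurd hj (Nat.not_lt_zero j)
  ι_inj := Function.injective_id
  left s j hj := absurd hj (Nat.not_lt_zero j)
  mid s u := rfl
  right s j _ u := rfl
  cyclic p hp _ := eq_top_iff.2 fun x _ => hp x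
  finite := H.finite
  finrank := by simp
  sing x w h := by
    refine ⟨⟨x, rfl⟩, fun j _ hj => ?_⟩
    refine H.inj w (fun i hi => ?_) j hj
    simpa [shiftMatrix] using h i hi
  fil := H.fil
  fil_mono := H.fil_mono
  fil_neg := H.fil_neg
  fil_top := H.fil_top
  fil_left i _ j hj := absurd hj (Nat.not_lt_zero j)
  fil_mid i hi k u hu := by
    rcases i with _ | i
    · simpa [shiftMatrix] using hu
    · simp [shiftMatrix]
  fil_right i hi j _ hj k u hu := by
    rcases i with _ | i
    · simp [shiftMatrix]
    · change H.Z i j u ∈ _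
      convert H.fil_apply i (by omega) j hj k u hu using 2
      push_cast
      ring
  φ := H.φ
  φ_ι _ := rfl
  φ_row j hj := absurd hj (Nat.not_lt_zero j)
  φ_left s j hj := absurd hj (Nat.not_lt_zero j)
  φ_right s j _ h u := H.φ_upper s j h u

/-- The operator of a stage, acting on functions with values in this stage. -/
def FockStage.lift {q : ℂ} {e n : ℕ} {H : FockModule q e n} {l : ℕ} (S : FockStage H l)
    (i j : ℕ) : Module.End ℂ (Fin (e + 1) → S.U) :=
  (S.Y i j).compLeft (Fin (e + 1))

/-- The matrix of the next stage. -/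
noncomputable def FockStage.nextY {q : ℂ} {e n : ℕ} {H : FockModule q e n} {l : ℕ}
    (S : FockStage H l) : ℕ → ℕ → Module.End ℂ (Fin (e + 1) → S.U) :=
  blockColumns S.lift l (oscRaise e S.U) (oscScale q e S.U) (oscLower q e S.U)

namespace FockStage

variable {q : ℂ} {e n : ℕ} {H : FockModule q e n} {l : ℕ} (S : FockStage H l)

@[simp] theorem lift_apply (i j : ℕ) (g : Fin (e + 1) → S.U) (p : Fin (e + 1)) :
    S.lift i j g p = S.Y i j (g p) := rfl

theorem nextY_left (i : ℕ) (g : Fin (e + 1) → S.U) :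
    S.nextY i l g = S.lift i l (oscRaise e S.U g) + S.lift i (l + 1) (oscScale q e S.U g) := by
  simp [nextY, blockColumns_left]

theorem nextY_right (i : ℕ) (g : Fin (e + 1) → S.U) :
    S.nextY i (l + 1) g =
      S.lift i l (oscScale q e S.U g) + S.lift i (l + 1) (oscLower q e S.U g) := by
  simp [nextY, blockColumns_right]

theorem nextY_of_ne {i j : ℕ} (h1 : j ≠ l) (h2 : j ≠ l + 1) : S.nextY i j = S.lift i j := by
  simp [nextY, blockColumns_of_ne h1 h2]

theorem lift_single (i j : ℕ) (p : Fin (e + 1)) (x : S.U) :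
    S.lift i j (Pi.single p x) = Pi.single p (S.Y i j x) :=
  compLeft_single _ _ _

theorem nextY_rel (hq0 : q ≠ 0) (hq : q ^ (2 * (e + 1)) = 1) : QuantumMatrix q S.nextY := by
  refine QuantumMatrix.blockColumns hq0 ?_ (oscRaise_mul_oscScale hq0) (oscScale_mul_oscLower hq0)
    (oscRaise_mul_oscLower hq0 hq) ?_ ?_ ?_
  · exact S.rel.map (fun f => f.compLeft (Fin (e + 1))) (fun _ _ => rfl) (fun _ _ => rfl)
      (fun _ _ => rfl)
  · intro i j
    refine LinearMap.ext fun g => funext fun p => ?_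
    refine Fin.cases ?_ (fun p => ?_) p <;> simp
  · intro i j
    refine LinearMap.ext fun g => funext fun p => ?_
    simp
  · intro i j
    refine LinearMap.ext fun g => funext fun p => ?_
    refine Fin.lastCases ?_ (fun p => ?_) p <;> simp

theorem nextY_row_left (g : Fin (e + 1) → S.U) :
    S.nextY 0 l g = S.lift 0 l (oscRaise e S.U g) := by
  rw [nextY_left, lift, lift, S.row_zero (l + 1) (Nat.lt_succ_self l)]
  exact add_zero _

theorem nextY_row_right (g : Fin (e + 1) → S.U) :
    S.nextY 0 (l + 1) g = S.lift 0 l (oscScale q e S.U g) := by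
  rw [nextY_right, lift, lift, S.row_zero (l + 1) (Nat.lt_succ_self l)]
  exact add_zero _

/-- The new matrix is the old one times the block, and both factors are injective; `w'` is the block
applied to `w`. -/
theorem nextY_inj (hq0 : q ≠ 0) (hq : q ^ (2 * (e + 1)) = 1) (hl : l < n)
    (w : ℕ → Fin (e + 1) → S.U)
    (hw : ∀ i < n + 1, ∑ j ∈ Finset.range (n + 1), S.nextY i j (w j) = 0) :
    ∀ j < n + 1, w j = 0 := by
  let w' : ℕ → Fin (e + 1) → S.U := fun j =>
    if j = l then oscRaise e S.U (w l) + oscScale q e S.U (w (l + 1))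
    else if j = l + 1 then oscScale q e S.U (w l) + oscLower q e S.U (w (l + 1))
    else w j
  have hsum : ∀ i, ∑ j ∈ Finset.range (n + 1), S.nextY i j (w j) =
      ∑ j ∈ Finset.range (n + 1), S.lift i j (w' j) := by
    intro i
    rw [← sub_eq_zero, ← Finset.sum_sub_distrib,
      Finset.sum_eq_add_of_mem l (l + 1) (by simp; omega) (by simp; omega) (by omega)]
    · simp only [nextY_left, nextY_right, w']
      simp
    · intro j _ hj
      rw [S.nextY_of_ne hj.1 hj.2]
      simp [w', hj.1, hj.2]
  have hw' : ∀ j < n + 1, w' j = 0 := by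
    intro j hj
    funext p
    refine S.inj (fun j => w' j p) (fun i hi => ?_) j hj
    have := congr_fun ((hsum i).symm.trans (hw i hi)) p
    simpa using this
  obtain ⟨h1, h2⟩ := oscBlock_injective hq0 hq (f := w l) (g := w (l + 1))
    (by simpa [w'] using hw' l (by omega)) (by simpa [w'] using hw' (l + 1) (by omega))
  intro j hj
  rcases eq_or_ne j l with rfl | h3
  · exact h1
  rcases eq_or_ne j (l + 1) with rfl | h4
  · exact h2
  · simpa [w', h3, h4] using hw' j hj

/-- The old entries of row `0` fill the vacuum level. The new one is raising composed with the
bijection `Y 0 l`, so it climbs through all levels. -/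
theorem nextY_cyclic (p : Submodule ℂ (Fin (e + 1) → S.U))
    (hι : ∀ u, Pi.single 0 (S.ι u) ∈ p) (hp : ∀ j < l + 1, ∀ x ∈ p, S.nextY 0 j x ∈ p) :
    p = ⊤ := by
  have h0 : ∀ x : S.U, Pi.single (0 : Fin (e + 1)) x ∈ p := by
    have := S.cyclic (p.comap (LinearMap.single ℂ (fun _ => S.U) 0)) hι (by
      intro j hj x hx
      have := hp j (by omega) _ hx
      rw [S.nextY_of_ne (by omega) (by omega)] at this
      simpa [lift_single] using this)
    intro x
    have hx : x ∈ (⊤ : Submodule ℂ S.U) := trivial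
    rw [← this] at hx
    exact hx
  have h1 : ∀ (r : Fin (e + 1)) (x : S.U), Pi.single r x ∈ p := by
    intro r
    induction r using Fin.induction with
    | zero => exact h0
    | succ r ih =>
      intro x
      obtain ⟨y, rfl⟩ := S.row_bij.2 x
      have := hp l (by omega) _ (ih y)
      rwa [nextY_row_left, oscRaise_single_castSucc, lift_single] at this
  rw [eq_top_iff]
  intro g _
  rw [← Finset.univ_sum_single g]
  exact Submodule.sum_mem _ fun r _ => h1 r _

/-- At each level this is the old equation for `oscScale x`, with `oscLower x` as the auxiliary
vector of index `l`. Hence `oscLower x = 0`, which confines `x` to the vacuum level. -/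
theorem nextY_sing (hq0 : q ≠ 0) (hq : ∀ p, 0 < p → p < e + 1 → q ^ (2 * p) ≠ 1) (hl : l < n)
    (x : Fin (e + 1) → S.U) (w : ℕ → Fin (e + 1) → S.U)
    (h : ∀ s < n, S.nextY (s + 1) (l + 1) x +
      ∑ j ∈ Finset.Ico (l + 1) n, S.nextY (s + 1) (j + 1) (w j) = 0) :
    (∃ u, Pi.single 0 (S.ι u) = x) ∧ ∀ j, l + 1 ≤ j → j < n → w j = 0 := by
  have key : ∀ r : Fin (e + 1), (∃ u, S.ι u = oscScale q e S.U x r) ∧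
      ∀ j, l ≤ j → j < n → (if j = l then oscLower q e S.U x r else w j r) = 0 := by
    intro r
    refine S.sing _ (fun j => if j = l then oscLower q e S.U x r else w j r) fun s hs => ?_
    rw [Finset.sum_eq_sum_Ico_succ_bot hl, if_pos rfl, ← add_assoc]
    have h1 := congr_fun (h s hs) r
    rw [nextY_right] at h1
    simp only [Pi.add_apply, Finset.sum_apply, lift_apply, Pi.zero_apply] at h1
    rw [← h1]
    congr 1
    refine Finset.sum_congr rfl fun j hj => ?_
    have := (Finset.mem_Ico.1 hj).1
    rw [if_neg (by omega), S.nextY_of_ne (by omega) (by omega), lift_apply]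
  have hd : oscLower q e S.U x = 0 := by
    funext r
    simpa using (key r).2 l le_rfl hl
  have hx := eq_zero_of_oscLower_eq_zero hq0 hq hd
  refine ⟨?_, fun j h1 h2 => funext fun r => ?_⟩
  · obtain ⟨u, hu⟩ := (key 0).1
    refine ⟨u, funext fun r => ?_⟩
    refine Fin.cases ?_ (fun r => ?_) r
    · simpa using hu
    · rw [hx, Pi.single_eq_of_ne (Fin.succ_ne_zero r)]
  · have := (key r).2 j (by omega) h2
    rwa [if_neg (by omega)] at this

/-- The filtration of the next stage. -/
def nextFil (k : ℤ) : Submodule ℂ (Fin (e + 1) → S.U) :=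
  -- Each quantum of the new oscillator has degree `n - l`, that of the entry in row `0` and column
  -- `l`.
  Submodule.pi Set.univ fun p => S.fil (k - (p : ℕ) * ((n : ℤ) - l))

theorem mem_nextFil {k : ℤ} {g : Fin (e + 1) → S.U} :
    g ∈ S.nextFil k ↔ ∀ p : Fin (e + 1), g p ∈ S.fil (k - (p : ℕ) * ((n : ℤ) - l)) := by
  simp [nextFil, Submodule.mem_pi]

theorem lift_mem_nextFil {i j : ℕ} {a : ℤ} (h : ∀ k, ∀ u ∈ S.fil k, S.Y i j u ∈ S.fil (k + a))
    {k k' : ℤ} (hk : k' = k + a) {g : Fin (e + 1) → S.U} (hg : g ∈ S.nextFil k) :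
    S.lift i j g ∈ S.nextFil k' := by
  rw [mem_nextFil] at hg ⊢
  intro p
  have := h _ _ (hg p)
  rw [lift_apply]
  convert this using 2
  rw [hk]
  ring

theorem oscRaise_mem_nextFil {k : ℤ} {g : Fin (e + 1) → S.U} (hg : g ∈ S.nextFil k) :
    oscRaise e S.U g ∈ S.nextFil (k + ((n : ℤ) - l)) := by
  rw [mem_nextFil] at hg ⊢
  intro p
  refine Fin.cases ?_ (fun p => ?_) p
  · simp
  · rw [oscRaise_succ]
    convert hg p.castSucc using 2
    simp
    ring

theorem oscScale_mem_nextFil {k : ℤ} {g : Fin (e + 1) → S.U} (hg : g ∈ S.nextFil k) :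
    oscScale q e S.U g ∈ S.nextFil k := by
  rw [mem_nextFil] at hg ⊢
  exact fun p => Submodule.smul_mem _ _ (hg p)

theorem oscLower_mem_nextFil {k : ℤ} {g : Fin (e + 1) → S.U} (hg : g ∈ S.nextFil k) :
    oscLower q e S.U g ∈ S.nextFil (k - ((n : ℤ) - l)) := by
  rw [mem_nextFil] at hg ⊢
  intro p
  refine Fin.lastCases ?_ (fun p => ?_) p
  · simp
  · rw [oscLower_castSucc]
    refine Submodule.smul_mem _ _ ?_
    convert hg p.succ using 2
    simp
    ring

/-- Adding one oscillator to a stage. -/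
noncomputable def next (hq0 : q ≠ 0) (hq : q ^ (2 * (e + 1)) = 1)
    (hq' : ∀ p, 0 < p → p < e + 1 → q ^ (2 * p) ≠ 1) (he : 0 < e) (hl : l < n) :
    FockStage H (l + 1) where
  U := Fin (e + 1) → S.U
  Y := S.nextY
  ι := LinearMap.single ℂ (fun _ => S.U) 0 ∘ₗ S.ι
  rel := S.nextY_rel hq0 hq
  inj := S.nextY_inj hq0 hq hl
  row_zero j hj := by
    rw [S.nextY_of_ne (by omega) (by omega), lift, S.row_zero j (by omega)]
    rfl
  row_bij := by
    have : ⇑(S.nextY 0 (l + 1)) = S.lift 0 l ∘ oscScale q e S.U :=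
      funext fun g => S.nextY_row_right g
    rw [this]
    refine Function.Bijective.comp ⟨?_, ?_⟩ ⟨oscScale_injective hq0, oscScale_surjective hq0⟩
    · intro f g h
      exact funext fun p => S.row_bij.1 (congr_fun h p)
    · intro g
      choose f hf using fun p => S.row_bij.2 (g p)
      exact ⟨f, funext hf⟩
  row_ι u := by
    simp only [LinearMap.comp_apply, LinearMap.single_apply]
    rw [nextY_row_right, oscScale_single_zero, lift_single, S.row_ι]
  row_pow j hj := by
    rcases (Nat.lt_succ_iff.1 hj).eq_or_lt with rfl | hj
    · have h1 : S.nextY 0 j = S.lift 0 j * oscRaise e S.U :=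
        LinearMap.ext fun g => S.nextY_row_left g
      have h2 : Commute (S.lift 0 j) (oscRaise e S.U) := by
        refine LinearMap.ext fun g => funext fun p => ?_
        refine Fin.cases ?_ (fun p => ?_) p <;> simp
      rw [h1, h2.mul_pow, oscRaise_pow, mul_zero]
    · rw [S.nextY_of_ne (by omega) (by omega)]
      have h1 : ∀ k : ℕ, S.lift 0 j ^ k = (S.Y 0 j ^ k).compLeft (Fin (e + 1)) := by
        intro k
        induction k with
        | zero => rfl
        | succ k ih => rw [pow_succ, ih, pow_succ]; rfl
      rw [h1, S.row_pow j hj]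
      rfl
  row_ne j hj u hu := by
    simp only [LinearMap.comp_apply, LinearMap.single_apply]
    rcases (Nat.lt_succ_iff.1 hj).eq_or_lt with rfl | hj
    -- Since `e > 0` there is a level above the vacuum, where the raised vector survives.
    · obtain ⟨e, rfl⟩ : ∃ e', e = e' + 1 := ⟨e - 1, by omega⟩
      rw [nextY_row_left]
      intro h
      have := congr_fun h (Fin.succ 0)
      simp only [lift_apply, oscRaise_succ, Fin.castSucc_zero, Pi.single_eq_same, S.row_ι,
        Pi.zero_apply] at this
      exact hu (S.ι_inj (by rw [this, map_zero]))
    · rw [S.nextY_of_ne (by omega) (by omega), lift_single]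
      simpa using S.row_ne j hj u hu
  ι_inj := (Pi.single_injective 0).comp S.ι_inj
  left s j hj u := by
    simp only [LinearMap.comp_apply, LinearMap.single_apply]
    rcases (Nat.lt_succ_iff.1 hj).eq_or_lt with rfl | hj
    · rw [nextY_left, oscScale_single_zero, lift_single, S.right s _ le_rfl]
      have : S.lift (s + 1) j (oscRaise e S.U (Pi.single 0 (S.ι u))) = 0 := by
        funext p
        refine Fin.cases ?_ (fun p => ?_) p
        · simp
        · rw [lift_apply, oscRaise_succ]
          rcases eq_or_ne p.castSucc 0 with hp | hp
          · rw [hp, Pi.single_eq_same, S.mid]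
            rfl
          · rw [Pi.single_eq_of_ne hp, map_zero]
            rfl
      rw [this, zero_add]
    · rw [S.nextY_of_ne (by omega) (by omega), lift_single, S.left s j hj]
  mid s u := by
    simp only [LinearMap.comp_apply, LinearMap.single_apply]
    rw [nextY_right, oscScale_single_zero, oscLower_single_zero, lift_single, S.mid, map_zero,
      Pi.single_zero, add_zero]
  right s j hj u := by
    simp only [LinearMap.comp_apply, LinearMap.single_apply]
    rw [S.nextY_of_ne (by omega) (by omega), lift_single, S.right s j (by omega)]
  cyclic := S.nextY_cyclic
  finite := by
    have := S.finite
    infer_instance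
  finrank := by
    have := S.finite
    rw [Module.finrank_pi_fintype, Finset.sum_const, S.finrank, Finset.card_univ, Fintype.card_fin,
      smul_eq_mul, pow_succ]
    ring
  sing := S.nextY_sing hq0 hq' hl
  fil := S.nextFil
  fil_mono a b hab g hg := by
    rw [mem_nextFil] at hg ⊢
    exact fun p => S.fil_mono (by omega) (hg p)
  fil_neg k hk := by
    rw [eq_bot_iff]
    intro g hg
    rw [mem_nextFil] at hg
    rw [Submodule.mem_bot]
    funext p
    have h1 : 0 ≤ ((p : ℕ) : ℤ) * ((n : ℤ) - l) := mul_nonneg (by omega) (by omega)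
    have := hg p
    rwa [S.fil_neg _ (by omega), Submodule.mem_bot] at this
  fil_top := by
    obtain ⟨k, hk⟩ := S.fil_top
    refine ⟨k + e * ((n : ℤ) - l), eq_top_iff.2 fun g _ => ?_⟩
    rw [mem_nextFil]
    intro p
    have h1 : ((p : ℕ) : ℤ) * ((n : ℤ) - l) ≤ e * ((n : ℤ) - l) :=
      mul_le_mul_of_nonneg_right (by have := p.2; omega) (by omega)
    refine S.fil_mono (show k ≤ _ by omega) ?_
    rw [hk]
    trivial
  fil_left i hi j hj k g hg := by
    rcases (Nat.lt_succ_iff.1 hj).eq_or_lt with rfl | hj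
    · rw [nextY_left]
      refine add_mem ?_ ?_
      · exact S.lift_mem_nextFil (a := -i) (fun k u hu => S.fil_mid i hi k u hu) (by ring)
          (S.oscRaise_mem_nextFil hg)
      · exact S.lift_mem_nextFil (fun k u hu => S.fil_right i hi j le_rfl hl k u hu) rfl
          (S.oscScale_mem_nextFil hg)
    · rw [S.nextY_of_ne (by omega) (by omega)]
      exact S.lift_mem_nextFil (fun k u hu => S.fil_left i hi j hj k u hu) rfl hg
  fil_mid i hi k g hg := by
    rw [nextY_right]
    refine add_mem ?_ ?_
    · exact S.lift_mem_nextFil (a := -i) (fun k u hu => S.fil_mid i hi k u hu) (by ring)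
        (S.oscScale_mem_nextFil hg)
    · exact S.lift_mem_nextFil (fun k u hu => S.fil_right i hi l le_rfl hl k u hu) (by ring)
        (S.oscLower_mem_nextFil hg)
  fil_right i hi j hj hjn k g hg := by
    rw [S.nextY_of_ne (by omega) (by omega)]
    exact S.lift_mem_nextFil (fun k u hu => S.fil_right i hi j (by omega) hjn k u hu) rfl hg
  φ := S.φ ∘ₗ LinearMap.proj 0
  φ_ι u := by simp [S.φ_ι]
  φ_row j hj g := by
    rcases (Nat.lt_succ_iff.1 hj).eq_or_lt with rfl | hj
    · simp [nextY_row_left]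
    · rw [S.nextY_of_ne (by omega) (by omega)]
      exact S.φ_row j hj _
  φ_left s j hj h g := by
    rcases (Nat.lt_succ_iff.1 hj).eq_or_lt with rfl | hj
    · simpa [nextY_left] using S.φ_right s j le_rfl h (g 0)
    · rw [S.nextY_of_ne (by omega) (by omega)]
      exact S.φ_left s j hj h _
  φ_right s j hj h g := by
    rw [S.nextY_of_ne (by omega) (by omega)]
    exact S.φ_right s j (by omega) h _

theorem exists_of_le (hq0 : q ≠ 0) (hq : q ^ (2 * (e + 1)) = 1)
    (hq' : ∀ p, 0 < p → p < e + 1 → q ^ (2 * p) ≠ 1) (he : 0 < e) (H : FockModule q e n) :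
    ∀ l ≤ n, Nonempty (FockStage H l) := by
  intro l
  induction l with
  | zero => exact fun _ => ⟨fockStageZero H⟩
  | succ l ih =>
    intro hl
    obtain ⟨S⟩ := ih (by omega)
    exact ⟨S.next hq0 hq hq' he (by omega)⟩

end FockStage

/-- The last stage is a Fock module for `n + 1`. -/
noncomputable def FockStage.toFockModule {q : ℂ} {e n : ℕ} {H : FockModule q e n}
    (S : FockStage H n) : FockModule q e (n + 1) where
  V := S.U
  Z := S.Y
  v := S.ι H.v
  rel := S.rel
  inj := S.inj
  lower i hi j hj h := by
    obtain ⟨s, rfl⟩ : ∃ s, i = s + 1 := ⟨i - 1, by omega⟩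
    rcases (Nat.lt_succ_iff.1 hj).eq_or_lt with rfl | hj
    · exact S.mid s _
    · rw [S.left s j hj, H.lower s (by omega) j hj (by omega), map_zero]
  diag i j h := by
    rcases i with _ | s
    · obtain rfl : j = n := by omega
      exact S.row_ι _
    · rw [S.left s j (by omega), H.diag s j (by omega)]
  upper_pow i j h := by
    rcases i with _ | s
    · rw [S.row_pow j (by omega)]
      rfl
    · have h1 : ∀ k : ℕ, (S.Y (s + 1) j ^ k) (S.ι H.v) = S.ι ((H.Z s j ^ k) H.v) := by
        intro k
        induction k with
        | zero => rfl
        | succ k ih =>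
          rw [pow_succ', Module.End.mul_apply, ih, S.left s j (by omega), pow_succ',
            Module.End.mul_apply]
      rw [h1, H.upper_pow s j (by omega), map_zero]
  upper_ne i j h := by
    rcases i with _ | s
    · refine S.row_ne j (by omega) _ fun h0 => ?_
      have := H.φ_v
      rw [h0, map_zero] at this
      exact zero_ne_one this
    · rw [S.left s j (by omega)]
      intro h0
      exact H.upper_ne s j (by omega) (S.ι_inj (by rw [h0, map_zero]))
  cyclic p hv hp := by
    have := H.cyclic (p.comap S.ι) hv (by
      intro i hi j hj u hu
      have := hp (i + 1) (by omega) j (by omega) _ hu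
      rwa [S.left i j hj] at this)
    refine S.cyclic p (fun u => ?_) fun j hj x hx => hp 0 (by omega) j (by omega) x hx
    have hu : u ∈ (⊤ : Submodule ℂ H.V) := trivial
    rw [← this] at hu
    exact hu
  finite := S.finite
  finrank := by
    rw [S.finrank, H.finrank, Finset.sum_range_succ, pow_add, mul_comm]
  sing x hx := by
    obtain ⟨⟨u, rfl⟩, -⟩ := S.sing x (fun _ => 0) (by
      intro s hs
      simpa using hx (s + 1) (by omega) n (by omega) (by omega))
    obtain ⟨c, rfl⟩ := H.sing u (by
      intro i hi j hj h
      have := hx (i + 1) (by omega) j (by omega) (by omega)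
      rw [S.left i j hj] at this
      exact S.ι_inj (by rw [this, map_zero]))
    exact ⟨c, map_smul _ _ _⟩
  fil := S.fil
  fil_mono := S.fil_mono
  fil_neg := S.fil_neg
  fil_top := S.fil_top
  fil_apply i hi j hj k u hu := by
    rcases (Nat.lt_succ_iff.1 hj).eq_or_lt with rfl | hj
    · convert S.fil_mid i (by omega) k u hu using 2
      push_cast
      ring
    · convert S.fil_left i (by omega) j hj k u hu using 2
      push_cast
      ring
  φ := S.φ
  φ_v := by rw [S.φ_ι, H.φ_v]
  φ_upper i j h u := by
    rcases i with _ | s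
    · exact S.φ_row j (by omega) u
    · exact S.φ_left s j (by omega) (by omega) u

theorem nonempty_fockModule {q : ℂ} {e : ℕ} (hq0 : q ≠ 0) (hq : q ^ (2 * (e + 1)) = 1)
    (hq' : ∀ p, 0 < p → p < e + 1 → q ^ (2 * p) ≠ 1) (he : 0 < e) :
    ∀ n, Nonempty (FockModule q e n) := by
  intro n
  induction n with
  | zero => exact ⟨fockModuleZero q e⟩
  | succ n ih =>
    obtain ⟨H⟩ := ih
    obtain ⟨S⟩ := FockStage.exists_of_le hq0 hq hq' he H n le_rfl
    exact ⟨S.toFockModule⟩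

/-! ### Relations in the modified algebra -/

section TorusRelations

variable {n : ℕ} {q : ℂ}

theorem weightPairing_add (ξ η : WeightLattice n) (α : RootLattice n) :
    weightPairing (ξ + η) α = weightPairing ξ α + weightPairing η α := by
  simp [weightPairing, add_mul, Finset.sum_add_distrib]

theorem torusL_zero : torusL n q 0 = 1 := by
  rw [torusL, toTorusMatrixAlgebra_rel TorusMatrixRel.torusOne, map_one]

theorem torusL_mul (ξ η : WeightLattice n) :
    torusL n q ξ * torusL n q η = torusL n q (ξ + η) := by
  rw [torusL, torusL, ← map_mul, toTorusMatrixAlgebra_rel (TorusMatrixRel.torusMul ξ η), torusL]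

theorem torusL_mul_matZ (ξ : WeightLattice n) (i j : Fin n) :
    torusL n q ξ * matZ n q i j =
      q ^ weightPairing ξ (rootZ i j) • (matZ n q i j * torusL n q ξ) := by
  rw [torusL, matZ, ← map_mul, toTorusMatrixAlgebra_rel (TorusMatrixRel.cross ξ i j), map_smul,
    map_mul]

theorem matZ_row {i j k : Fin n} (h : j < k) :
    matZ n q i j * matZ n q i k = q • (matZ n q i k * matZ n q i j) := by
  simp only [matZ, ← map_mul, ← map_smul]
  exact toTorusMatrixAlgebra_rel (TorusMatrixRel.row i j k h)

theorem matZ_col {i j k : Fin n} (h : i < k) :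
    matZ n q i j * matZ n q k j = q • (matZ n q k j * matZ n q i j) := by
  simp only [matZ, ← map_mul, ← map_smul]
  exact toTorusMatrixAlgebra_rel (TorusMatrixRel.col i j k h)

theorem matZ_anti {i j s t : Fin n} (h : i < s) (h' : t < j) :
    matZ n q i j * matZ n q s t = matZ n q s t * matZ n q i j := by
  simp only [matZ, ← map_mul]
  exact toTorusMatrixAlgebra_rel (TorusMatrixRel.anti i j s t h h')

theorem matZ_diag {i j s t : Fin n} (h : i < s) (h' : j < t) :
    matZ n q i j * matZ n q s t =
      matZ n q s t * matZ n q i j + (q - q⁻¹) • (matZ n q i t * matZ n q s j) := by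
  simp only [matZ, ← map_mul, ← map_smul, ← map_add]
  exact toTorusMatrixAlgebra_rel (TorusMatrixRel.diag i j s t h h')

/-- Entries which are not in crossing position commute up to a scalar. -/
theorem exists_matZ_mul_eq (hq : q ≠ 0) {i j s t : Fin n} (h1 : ¬ (i < s ∧ j < t))
    (h2 : ¬ (s < i ∧ t < j)) :
    ∃ c : ℂ, matZ n q i j * matZ n q s t = c • (matZ n q s t * matZ n q i j) := by
  rcases lt_trichotomy i s with his | rfl | his
  · rcases lt_trichotomy j t with hjt | rfl | hjt
    · exact absurd ⟨his, hjt⟩ h1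
    · exact ⟨q, matZ_col his⟩
    · exact ⟨1, by rw [one_smul, matZ_anti his hjt]⟩
  · rcases lt_trichotomy j t with hjt | rfl | hjt
    · exact ⟨q, matZ_row hjt⟩
    · exact ⟨1, by rw [one_smul]⟩
    · exact ⟨q⁻¹, by rw [matZ_row hjt, smul_smul, inv_mul_cancel₀ hq, one_smul]⟩
  · rcases lt_trichotomy j t with hjt | rfl | hjt
    · exact ⟨1, by rw [one_smul, matZ_anti his hjt]⟩
    · exact ⟨q⁻¹, by rw [matZ_col his, smul_smul, inv_mul_cancel₀ hq, one_smul]⟩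
    · exact absurd ⟨his, hjt⟩ h2

/-- The powers of an entry and an entry commuting with it up to a scalar and a correction. -/
theorem pow_mul_eq_of_crossing {R : Type*} [Ring R] [Algebra ℂ R] {x y z : R} {κ p : ℂ}
    (h : x * y = y * x + κ • z) (hz : x * z = p • (z * x)) (k : ℕ) :
    x ^ (k + 1) * y = y * x ^ (k + 1) +
      (κ * ∑ i ∈ Finset.range (k + 1), p ^ i) • (z * x ^ k) := by
  induction k with
  | zero => simpa using h
  | succ k ih =>
    rw [pow_succ' x (k + 1), mul_assoc, ih, mul_add, ← mul_assoc, h, mul_smul_comm, ← mul_assoc x z,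
      hz, add_mul, smul_mul_assoc, smul_mul_assoc, mul_assoc, mul_assoc z, ← pow_succ',
      ← pow_succ', Finset.sum_range_succ' _ (k + 1), add_assoc]
    congr 1
    simp only [pow_succ p, ← Finset.sum_mul]
    module

/-- In crossing position the correction carries a geometric sum of `e + 1` powers of `q ^ 2` or its
inverse, which vanishes because `q ^ 2` is a nontrivial root of unity of order dividing `e + 1`. -/
theorem exists_matZ_pow_mul_eq (hq : q ≠ 0) {e : ℕ} (h1 : (q ^ 2) ^ (e + 1) = 1) (h2 : q ^ 2 ≠ 1)
    (i j s t : Fin n) :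
    ∃ c : ℂ, matZ n q i j ^ (e + 1) * matZ n q s t =
      c • (matZ n q s t * matZ n q i j ^ (e + 1)) := by
  have hgeom : ∀ p : ℂ, p ^ (e + 1) = 1 → p ≠ 1 → ∑ i ∈ Finset.range (e + 1), p ^ i = 0 := by
    intro p h1 h2
    rw [geom_sum_eq h2, h1, sub_self, zero_div]
  by_cases c1 : i < s ∧ j < t
  · have := pow_mul_eq_of_crossing (p := q ^ 2) (matZ_diag (q := q) c1.1 c1.2) (by
      rw [← mul_assoc, matZ_row c1.2, smul_mul_assoc, mul_assoc, matZ_col c1.1, mul_smul_comm,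
        smul_smul, mul_assoc, pow_two]) e
    refine ⟨1, ?_⟩
    rw [this, hgeom _ h1 h2, mul_zero, zero_smul, add_zero, one_smul]
  by_cases c2 : s < i ∧ t < j
  · have e1 : matZ n q i j * matZ n q s t = matZ n q s t * matZ n q i j +
        (-(q - q⁻¹)) • (matZ n q s j * matZ n q i t) := by
      rw [matZ_diag c2.1 c2.2]
      module
    have e2 : matZ n q i j * (matZ n q s j * matZ n q i t) =
        (q ^ 2)⁻¹ • (matZ n q s j * matZ n q i t * matZ n q i j) := by
      rw [eq_inv_smul_iff₀ (pow_ne_zero 2 hq), mul_assoc, matZ_row c2.2, mul_smul_comm, ← mul_assoc,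
        ← mul_assoc, matZ_col c2.1, smul_mul_assoc, smul_smul, pow_two]
    refine ⟨1, ?_⟩
    rw [pow_mul_eq_of_crossing e1 e2, hgeom _ (by rw [inv_pow, h1, inv_one])
      (fun h => h2 (inv_eq_one.1 h)), mul_zero, zero_smul, add_zero, one_smul]
  obtain ⟨c, hc⟩ := exists_matZ_mul_eq hq c1 c2
  refine ⟨c ^ (e + 1), ?_⟩
  generalize e + 1 = k
  induction k with
  | zero => simp
  | succ k ih =>
    rw [pow_succ, mul_assoc, hc, mul_smul_comm, ← mul_assoc, ih, smul_mul_assoc, smul_smul,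
      mul_assoc, pow_succ' c]

variable (w : ModificationDatum n)

theorem modZ_eq (i j : Fin n) :
    modZ q w i j = matZ n q i j * torusL n q (w.ζ i + w.ξ j) := by
  rw [modZ, mul_assoc, torusL_mul]

theorem mul_torusL_mul_matZ (x y : TorusMatrixAlgebra n q) (ξ : WeightLattice n) (i j : Fin n) :
    x * torusL n q ξ * (matZ n q i j * y) =
      q ^ weightPairing ξ (rootZ i j) • (x * matZ n q i j * (torusL n q ξ * y)) := by
  rw [mul_assoc, ← mul_assoc (torusL n q ξ), torusL_mul_matZ]
  simp only [smul_mul_assoc, mul_smul_comm, mul_assoc]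

theorem modZ_mul_modZ (i j s t : Fin n) :
    modZ q w i j * modZ q w s t = q ^ weightPairing (w.ζ i + w.ξ j) (rootZ s t) •
      (matZ n q i j * matZ n q s t * torusL n q (w.ζ i + w.ξ j + (w.ζ s + w.ξ t))) := by
  rw [modZ_eq, modZ_eq, mul_torusL_mul_matZ, torusL_mul]

theorem exists_modZ_mul_eq (hq : q ≠ 0) {i j s t : Fin n} (h1 : ¬ (i < s ∧ j < t))
    (h2 : ¬ (s < i ∧ t < j)) :
    ∃ c : ℂ, modZ q w i j * modZ q w s t = c • (modZ q w s t * modZ q w i j) := by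
  obtain ⟨c, hc⟩ := exists_matZ_mul_eq hq h1 h2
  rw [modZ_mul_modZ, modZ_mul_modZ, hc]
  have h3 := zpow_ne_zero (weightPairing (w.ζ s + w.ξ t) (rootZ i j)) hq
  refine ⟨(q ^ weightPairing (w.ζ s + w.ξ t) (rootZ i j))⁻¹ *
    (q ^ weightPairing (w.ζ i + w.ξ j) (rootZ s t) * c), ?_⟩
  rw [smul_smul, mul_right_comm, inv_mul_cancel₀ h3, one_mul, smul_mul_assoc, smul_smul,
    add_comm (w.ζ s + w.ξ t)]

theorem exists_modZ_mul_eq_add (hq : q ≠ 0) {i j s t : Fin n} (h1 : s < i) (h2 : t < j) :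
    ∃ c d : ℂ, modZ q w i j * modZ q w s t =
      c • (modZ q w s t * modZ q w i j) + d • (modZ q w s j * modZ q w i t) := by
  have h3 := zpow_ne_zero (weightPairing (w.ζ s + w.ξ t) (rootZ i j)) hq
  have h4 := zpow_ne_zero (weightPairing (w.ζ s + w.ξ j) (rootZ i t)) hq
  refine ⟨q ^ weightPairing (w.ζ i + w.ξ j) (rootZ s t) *
    (q ^ weightPairing (w.ζ s + w.ξ t) (rootZ i j))⁻¹,
    - (q ^ weightPairing (w.ζ i + w.ξ j) (rootZ s t) * (q - q⁻¹)) *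
    (q ^ weightPairing (w.ζ s + w.ξ j) (rootZ i t))⁻¹, ?_⟩
  simp only [modZ_mul_modZ, smul_smul]
  rw [inv_mul_cancel_right₀ h3, inv_mul_cancel_right₀ h4, matZ_diag h1 h2,
    show w.ζ s + w.ξ j + (w.ζ i + w.ξ t) = w.ζ i + w.ξ j + (w.ζ s + w.ξ t) by abel,
    show w.ζ s + w.ξ t + (w.ζ i + w.ξ j) = w.ζ i + w.ξ j + (w.ζ s + w.ξ t) by abel, add_mul,
    smul_mul_assoc]
  module

theorem exists_modZ_pow_eq (hq : q ≠ 0) (i j : Fin n) (k : ℕ) :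
    ∃ c : ℂ, c ≠ 0 ∧
      modZ q w i j ^ k = c • (matZ n q i j ^ k * torusL n q (k • (w.ζ i + w.ξ j))) := by
  induction k with
  | zero => exact ⟨1, one_ne_zero, by simp [torusL_zero]⟩
  | succ k ih =>
    obtain ⟨c, hc, h⟩ := ih
    refine ⟨c * q ^ weightPairing (k • (w.ζ i + w.ξ j)) (rootZ i j),
      mul_ne_zero hc (zpow_ne_zero _ hq), ?_⟩
    rw [pow_succ, h, smul_mul_assoc, modZ_eq, mul_torusL_mul_matZ, torusL_mul, smul_smul,
      ← pow_succ, succ_nsmul]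

theorem exists_modZ_pow_mul_eq (hq : q ≠ 0) {e : ℕ} (h1 : (q ^ 2) ^ (e + 1) = 1)
    (h2 : q ^ 2 ≠ 1) (i j s t : Fin n) :
    ∃ c : ℂ, modZ q w i j ^ (e + 1) * modZ q w s t =
      c • (modZ q w s t * modZ q w i j ^ (e + 1)) := by
  obtain ⟨c, hc, h⟩ := exists_modZ_pow_eq (q := q) w hq i j (e + 1)
  obtain ⟨d, hd⟩ := exists_matZ_pow_mul_eq hq h1 h2 i j s t
  have h3 : ∃ d' : ℂ, d' ≠ 0 ∧ modZ q w s t * modZ q w i j ^ (e + 1) =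
      d' • (matZ n q s t * matZ n q i j ^ (e + 1) *
        torusL n q ((w.ζ s + w.ξ t) + (e + 1) • (w.ζ i + w.ξ j))) := by
    have h4 : ∀ k : ℕ, torusL n q (w.ζ s + w.ξ t) * matZ n q i j ^ k =
        (q ^ weightPairing (w.ζ s + w.ξ t) (rootZ i j)) ^ k •
          (matZ n q i j ^ k * torusL n q (w.ζ s + w.ξ t)) := by
      intro k
      induction k with
      | zero => simp
      | succ k ih =>
        rw [pow_succ, ← mul_assoc, ih, smul_mul_assoc, mul_assoc, torusL_mul_matZ, mul_smul_comm,
          smul_smul, ← mul_assoc, ← pow_succ]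
    refine ⟨c * (q ^ weightPairing (w.ζ s + w.ξ t) (rootZ i j)) ^ (e + 1),
      mul_ne_zero hc (pow_ne_zero _ (zpow_ne_zero _ hq)), ?_⟩
    rw [h, modZ_eq, mul_smul_comm, mul_assoc, ← mul_assoc (torusL n q _), h4, smul_mul_assoc,
      mul_smul_comm, smul_smul, mul_assoc _ (torusL n q _), torusL_mul, mul_assoc]
  obtain ⟨d', hd', h5⟩ := h3
  refine ⟨c * q ^ weightPairing ((e + 1) • (w.ζ i + w.ξ j)) (rootZ s t) * d * d'⁻¹, ?_⟩
  rw [h5, smul_smul, inv_mul_cancel_right₀ hd', h, modZ_eq, smul_mul_assoc, mul_torusL_mul_matZ,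
    torusL_mul, hd, smul_mul_assoc, smul_smul, smul_smul, add_comm (w.ζ s + w.ξ t), mul_assoc c]

/-- The generators of the modified algebra, with the columns in reversed order. -/
noncomputable def revGen (q : ℂ) (w : ModificationDatum n) (i j : Fin n) : modifiedAlgebra q w :=
  modGen q w i j.rev

theorem straightening_revGen (hq : q ≠ 0) : Straightening (revGen q w) where
  skew i j a b h1 h2 := by
    obtain ⟨c, hc⟩ := exists_modZ_mul_eq (q := q) w hq (i := i) (j := j.rev) (s := a) (t := b.rev)
      (by simpa using h1) (by simpa using h2)
    exact ⟨c, Subtype.ext hc⟩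
  cross i j a b h1 h2 := by
    obtain ⟨c, d, hc⟩ := exists_modZ_mul_eq_add (q := q) w hq (i := i) (j := j.rev) (s := a)
      (t := b.rev) h1 (Fin.rev_lt_rev.2 h2)
    exact ⟨c, d, Subtype.ext hc⟩

theorem exists_revGen_pow_mul_eq (hq : q ≠ 0) {e : ℕ} (h1 : (q ^ 2) ^ (e + 1) = 1)
    (h2 : q ^ 2 ≠ 1) (i j s t : Fin n) :
    ∃ c : ℂ, revGen q w i j ^ (e + 1) * revGen q w s t =
      c • (revGen q w s t * revGen q w i j ^ (e + 1)) := by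
  obtain ⟨c, hc⟩ := exists_modZ_pow_mul_eq (q := q) w hq h1 h2 i j.rev s t.rev
  exact ⟨c, Subtype.ext hc⟩

/-- The modified algebra is generated by the `revGen q w i j`. -/
theorem modifiedAlgebra_stable {M : Type*} [AddCommGroup M] [Module ℂ M]
    (ρ : modifiedAlgebra q w →ₐ[ℂ] Module.End ℂ M) (T : Submodule ℂ M)
    (hT : ∀ i j, ∀ u ∈ T, ρ (revGen q w i j) u ∈ T) (y : modifiedAlgebra q w) :
    ∀ u ∈ T, ρ y u ∈ T := by
  obtain ⟨y, hy⟩ := y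
  change y ∈ Algebra.adjoin ℂ _ at hy
  induction hy using Algebra.adjoin_induction with
  | mem x hx =>
    obtain ⟨i, j, rfl⟩ := hx
    intro u hu
    have := hT i j.rev u hu
    simp only [revGen, Fin.rev_rev] at this
    exact this
  | algebraMap r =>
    intro u hu
    have : ρ ⟨algebraMap ℂ _ r, Subalgebra.algebraMap_mem _ r⟩ = algebraMap ℂ _ r :=
      ρ.commutes r
    rw [this]
    exact T.smul_mem r hu
  | add x y hx hy ihx ihy =>
    intro u hu
    have : ρ ⟨x + y, add_mem hx hy⟩ = ρ ⟨x, hx⟩ + ρ ⟨y, hy⟩ := map_add ρ ⟨x, hx⟩ ⟨y, hy⟩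
    rw [this]
    exact add_mem (ihx u hu) (ihy u hu)
  | mul x y hx hy ihx ihy =>
    intro u hu
    have : ρ ⟨x * y, mul_mem hx hy⟩ = ρ ⟨x, hx⟩ * ρ ⟨y, hy⟩ := map_mul ρ ⟨x, hx⟩ ⟨y, hy⟩
    rw [this]
    exact ihx _ (ihy u hu)

end TorusRelations

/-! ### Representations on functions on the weight lattice -/

/-- All terms of a relation involve the same rows and columns. This freedom adjusts the eigenvalues
to a given `Λ`. -/
theorem QuantumMatrix.scale {R : Type*} [Ring R] [Algebra ℂ R] {q : ℂ} {Y : ℕ → ℕ → R}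
    (h : QuantumMatrix q Y) (r c : ℕ → ℂ) : QuantumMatrix q fun i j => (r i * c j) • Y i j where
  row i j k hjk := by
    rw [smul_mul_smul_comm, smul_mul_smul_comm, h.row i j k hjk, mul_comm (r i * c j), smul_comm]
  col i j k hik := by
    rw [smul_mul_smul_comm, smul_mul_smul_comm, h.col i j k hik, mul_comm (r i * c j), smul_comm]
  anti i j s t h1 h2 := by
    rw [smul_mul_smul_comm, smul_mul_smul_comm, h.anti i j s t h1 h2, mul_comm (r i * c j)]
  diag i j s t h1 h2 := by
    simp only [smul_mul_smul_comm, h.diag i j s t h1 h2]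
    module

section TorusRep

variable {n : ℕ} {q : ℂ} {V : Type*} [AddCommGroup V] [Module ℂ V]

/-- The operators by which the generators act on functions on the weight lattice. -/
noncomputable def torusRepGen (n : ℕ) (q : ℂ) (Y : ℕ → ℕ → Module.End ℂ V) :
    TorusMatrixGen n → Module.End ℂ (WeightLattice n → V)
  | .Z i j =>
    { toFun := fun h η => q ^ weightPairing η (rootZ i j) • Y i j (h η)
      map_add' := fun f g => funext fun η => by simp
      map_smul' := fun c f => funext fun η => by simp [smul_comm c] }
  | .L ξ => LinearMap.funLeft ℂ V fun η => η + ξ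

/-- A module over the quantized matrix algebra yields a module over its semidirect product with
the torus, consisting of functions on the weight lattice. -/
noncomputable def torusRep (hq : q ≠ 0) {Y : ℕ → ℕ → Module.End ℂ V} (hY : QuantumMatrix q Y) :
    TorusMatrixAlgebra n q →ₐ[ℂ] Module.End ℂ (WeightLattice n → V) :=
  RingQuot.liftAlgHom ℂ (s := TorusMatrixRel n q) ⟨FreeAlgebra.lift ℂ (torusRepGen n q Y), by
    intro x y hxy
    induction hxy with
    | row i j k hjk =>
      refine LinearMap.ext fun h => funext fun η => ?_
      have := LinearMap.congr_fun (hY.row i j k hjk) (h η)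
      simp only [Module.End.mul_apply, LinearMap.smul_apply] at this
      simp only [freeZ, map_mul, map_smul, FreeAlgebra.lift_ι_apply, Module.End.mul_apply,
        LinearMap.smul_apply, Pi.smul_apply, torusRepGen, LinearMap.coe_mk, AddHom.coe_mk, this]
      module
    | col i j k hik =>
      refine LinearMap.ext fun h => funext fun η => ?_
      have := LinearMap.congr_fun (hY.col i j k hik) (h η)
      simp only [Module.End.mul_apply, LinearMap.smul_apply] at this
      simp only [freeZ, map_mul, map_smul, FreeAlgebra.lift_ι_apply, Module.End.mul_apply,
        LinearMap.smul_apply, Pi.smul_apply, torusRepGen, LinearMap.coe_mk, AddHom.coe_mk, this]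
      module
    | anti i j s t his htj =>
      refine LinearMap.ext fun h => funext fun η => ?_
      have := LinearMap.congr_fun (hY.anti i j s t his htj) (h η)
      simp only [Module.End.mul_apply] at this
      simp only [freeZ, map_mul, map_smul, FreeAlgebra.lift_ι_apply, Module.End.mul_apply,
        torusRepGen, LinearMap.coe_mk, AddHom.coe_mk, this]
      module
    | diag i j s t his hjt =>
      refine LinearMap.ext fun h => funext fun η => ?_
      have := LinearMap.congr_fun (hY.diag i j s t his hjt) (h η)
      simp only [Module.End.mul_apply, LinearMap.smul_apply, LinearMap.add_apply] at this
      -- Both products in the relation have the same weight: `α_{i,t} + α_{s,j} = α_{i,j} +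
      -- α_{s,t}`.
      have e1 : weightPairing η (rootZ i t) + weightPairing η (rootZ s j) =
          weightPairing η (rootZ i j) + weightPairing η (rootZ s t) := by
        simp only [weightPairing, ← Finset.sum_add_distrib]
        refine Finset.sum_congr rfl fun k _ => ?_
        rcases k with _ | _ | _ <;> simp [rootZ] <;> ring
      have e2 := congrArg (fun z : ℤ => q ^ z) e1
      simp only [zpow_add₀ hq] at e2
      simp only [freeZ, map_add, map_mul, map_smul, FreeAlgebra.lift_ι_apply, Module.End.mul_apply,
        LinearMap.smul_apply, LinearMap.add_apply, Pi.add_apply, Pi.smul_apply, torusRepGen,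
        LinearMap.coe_mk, AddHom.coe_mk, this, smul_smul, e2]
      module
    | torusOne =>
      refine LinearMap.ext fun h => funext fun η => ?_
      simp [freeL, torusRepGen, LinearMap.funLeft_apply]
    | torusMul ξ η =>
      refine LinearMap.ext fun h => funext fun η => ?_
      simp [freeL, torusRepGen, LinearMap.funLeft_apply, add_assoc]
    | cross ξ i j =>
      refine LinearMap.ext fun h => funext fun η => ?_
      simp [freeL, freeZ, torusRepGen, LinearMap.funLeft_apply, weightPairing_add, zpow_add₀ hq,
        smul_smul, mul_comm]⟩

variable (hq : q ≠ 0) {Y : ℕ → ℕ → Module.End ℂ V} (hY : QuantumMatrix q Y)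

theorem torusRep_matZ (i j : Fin n) (h : WeightLattice n → V) (η : WeightLattice n) :
    torusRep hq hY (matZ n q i j) h η = q ^ weightPairing η (rootZ i j) • Y i j (h η) := by
  have : torusRep hq hY (matZ n q i j) = torusRepGen n q Y (.Z i j) :=
    (RingQuot.liftAlgHom_mkAlgHom_apply ℂ _ _ _).trans (FreeAlgebra.lift_ι_apply _ _)
  rw [this]
  rfl

theorem torusRep_torusL (ξ : WeightLattice n) (h : WeightLattice n → V) (η : WeightLattice n) :
    torusRep hq hY (torusL n q ξ) h η = h (η + ξ) := by
  have : torusRep hq hY (torusL n q ξ) = torusRepGen n q Y (.L ξ) :=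
    (RingQuot.liftAlgHom_mkAlgHom_apply ℂ _ _ _).trans (FreeAlgebra.lift_ι_apply _ _)
  rw [this]
  rfl

/-- The weighted shift of functions on the weight lattice given by a modified generator. -/
noncomputable def weightedShift (q : ℂ) (w : ModificationDatum n) (i j : Fin n) :
    Module.End ℂ (WeightLattice n → ℂ) where
  toFun f η := q ^ weightPairing η (rootZ i j) * f (η + (w.ζ i + w.ξ j))
  map_add' f g := funext fun η => by simp [mul_add]
  map_smul' c f := funext fun η => by simp [mul_left_comm]

theorem weightedShift_apply (w : ModificationDatum n) (i j : Fin n) (f : WeightLattice n → ℂ)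
    (η : WeightLattice n) : weightedShift q w i j f η =
      q ^ weightPairing η (rootZ i j) * f (η + (w.ζ i + w.ξ j)) := rfl

theorem weightedShift_ne_zero (hq : q ≠ 0) (w : ModificationDatum n) (i j : Fin n)
    {f : WeightLattice n → ℂ} (hf : f ≠ 0) : weightedShift q w i j f ≠ 0 := by
  contrapose! hf
  funext η
  have := congr_fun hf (η - (w.ζ i + w.ξ j))
  simpa [weightedShift_apply, zpow_ne_zero _ hq] using this

theorem torusRep_modZ (w : ModificationDatum n) (i j : Fin n) (h : WeightLattice n → V)
    (η : WeightLattice n) : torusRep hq hY (modZ q w i j) h η =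
      q ^ weightPairing η (rootZ i j) • Y i j (h (η + (w.ζ i + w.ξ j))) := by
  rw [modZ_eq, map_mul, Module.End.mul_apply, torusRep_matZ, torusRep_torusL]

theorem torusRep_modZ_smul (w : ModificationDatum n) (i j : Fin n) (f : WeightLattice n → ℂ)
    (u : V) : torusRep hq hY (modZ q w i j) (fun η => f η • u) =
      fun η => weightedShift q w i j f η • Y i j u := by
  funext η
  rw [torusRep_modZ, map_smul, smul_smul, weightedShift_apply]

end TorusRep

/-- Commuting operators have a common eigenvector in a finite-dimensional invariant subspace. -/
theorem exists_common_eigenvector {κ E : Type*} [Fintype κ] [AddCommGroup E] [Module ℂ E]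
    (T : κ → Module.End ℂ E) (hT : ∀ k l, T k * T l = T l * T k) (p : Submodule ℂ E)
    [FiniteDimensional ℂ p] (hp : p ≠ ⊥) (hs : ∀ k, ∀ u ∈ p, T k u ∈ p) :
    ∃ u : E, u ≠ 0 ∧ ∃ c : κ → ℂ, ∀ k, T k u = c k • u := by
  classical
  suffices H : ∀ s : Finset κ, ∃ p' ≤ p, p' ≠ ⊥ ∧ (∀ k, ∀ u ∈ p', T k u ∈ p') ∧
      ∃ c : κ → ℂ, ∀ k ∈ s, ∀ u ∈ p', T k u = c k • u by
    obtain ⟨p', -, h2, -, c, h4⟩ := H Finset.univ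
    obtain ⟨u, hu, hu0⟩ := p'.ne_bot_iff.1 h2
    exact ⟨u, hu0, c, fun k => h4 k (Finset.mem_univ k) u hu⟩
  intro s
  induction s using Finset.induction_on with
  | empty => exact ⟨p, le_rfl, hp, hs, 0, by simp⟩
  | insert k s hk ih =>
    obtain ⟨p', h1, h2, h3, c, h4⟩ := ih
    have : FiniteDimensional ℂ p' := Submodule.finiteDimensional_of_le h1
    have : Nontrivial p' := (Submodule.nontrivial_iff_ne_bot).2 h2
    obtain ⟨μ, hμ⟩ := Module.End.exists_eigenvalue ((T k).restrict (h3 k))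
    obtain ⟨⟨u, hu⟩, hu1⟩ := hμ.exists_hasEigenvector
    refine ⟨p' ⊓ Module.End.eigenspace (T k) μ, inf_le_left.trans h1, ?_, ?_,
      Function.update c k μ, ?_⟩
    · refine (Submodule.ne_bot_iff _).2 ⟨u, ⟨hu, ?_⟩, fun h => hu1.2 (Subtype.ext h)⟩
      rw [SetLike.mem_coe, Module.End.mem_eigenspace_iff]
      exact congrArg Subtype.val hu1.apply_eq_smul
    · rintro l u ⟨hu, hu'⟩
      refine ⟨h3 l u hu, ?_⟩
      rw [SetLike.mem_coe, Module.End.mem_eigenspace_iff] at hu' ⊢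
      rw [← Module.End.mul_apply, hT, Module.End.mul_apply, hu', map_smul]
    · rintro l hl u ⟨hu, hu'⟩
      rcases eq_or_ne l k with rfl | hne
      · rw [Function.update_self]
        exact Module.End.mem_eigenspace_iff.1 hu'
      · rw [Function.update_of_ne hne]
        exact h4 l (Finset.mem_of_mem_insert_of_ne hl hne) u hu

theorem zpow_weightPairing_congr {n m : ℕ} {q : ℂ} (hq0 : q ≠ 0) (hq : q ^ m = 1)
    {η η' : WeightLattice n} (h : ∀ k, (η k : ZMod m) = η' k) (α : RootLattice n) :
    q ^ weightPairing η α = q ^ weightPairing η' α := by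
  have hd : (m : ℤ) ∣ weightPairing η α - weightPairing η' α := by
    simp only [weightPairing, ← Finset.sum_sub_distrib, ← sub_mul]
    refine Finset.dvd_sum fun k _ => Dvd.dvd.mul_right ?_ _
    rw [← ZMod.intCast_zmod_eq_zero_iff_dvd]
    simp [h k]
  obtain ⟨t, ht⟩ := hd
  rw [sub_eq_iff_eq_add] at ht
  rw [ht, zpow_add₀ hq0, zpow_mul, zpow_natCast, hq, one_zpow, one_mul]

/-- The weighted shifts of the antidiagonal generators have a common eigenfunction, with nonzero
eigenvalues. -/
theorem exists_eigenfunction {n m : ℕ} {q : ℂ} (hm : m ≠ 0) (hq : q ^ m = 1)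
    (w : ModificationDatum n)
    (hw : ∀ k l : Fin n, weightedShift q w k k.rev * weightedShift q w l l.rev =
      weightedShift q w l l.rev * weightedShift q w k k.rev) :
    ∃ f : WeightLattice n → ℂ, f ≠ 0 ∧ ∃ c : Fin n → ℂ, (∀ k, c k ≠ 0) ∧
      ∀ k, weightedShift q w k k.rev f = c k • f := by
  have hq0 : q ≠ 0 := by
    rintro rfl
    rw [zero_pow hm] at hq
    exact zero_ne_one hq
  have : NeZero m := ⟨hm⟩
  let red : WeightLattice n → SimpleRoot n → ZMod m := fun η k => (η k : ZMod m)
  let lft : (SimpleRoot n → ZMod m) → WeightLattice n := fun s k => ((s k).val : ℤ)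
  have hred : ∀ s, red (lft s) = s := fun s => funext fun k => by simp [red, lft]
  -- The `m`-periodic functions: a finite-dimensional space, stable under the weighted shifts
  -- because `q ^ m = 1`.
  let p : Submodule ℂ (WeightLattice n → ℂ) := LinearMap.range (LinearMap.funLeft ℂ ℂ red)
  obtain ⟨f, hf, c, hc⟩ := exists_common_eigenvector
    (fun k : Fin n => weightedShift q w k k.rev) hw p
    ((Submodule.ne_bot_iff _).2 ⟨1, ⟨1, rfl⟩, one_ne_zero⟩) (by
      rintro k _ ⟨g, rfl⟩
      refine ⟨fun s => q ^ weightPairing (lft s) (rootZ k k.rev) *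
        g (s + red (w.ζ k + w.ξ k.rev)), funext fun η => ?_⟩
      rw [LinearMap.funLeft_apply, weightedShift_apply, LinearMap.funLeft_apply]
      congr 1
      · exact zpow_weightPairing_congr hq0 hq (fun k => congr_fun (hred (red η)) k) _
      · congr 1
        funext k
        simp [red])
  refine ⟨f, hf, c, fun k hk => ?_, hc⟩
  have := hc k
  rw [hk, zero_smul] at this
  exact weightedShift_ne_zero hq0 w k k.rev hf this

section ModifiedRep

variable {n e : ℕ} {q : ℂ} {w : ModificationDatum n}

/-- A function on `Fin n`, extended by `1` to the natural numbers. -/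
noncomputable def extendOne (r : Fin n → ℂ) (i : ℕ) : ℂ := if h : i < n then r ⟨i, h⟩ else 1

theorem extendOne_coe (r : Fin n → ℂ) (i : Fin n) : extendOne r i = r i := by
  simp [extendOne]

/-- The quantum matrix of a Fock module with rescaled rows and (reversed) columns. -/
noncomputable def scaledZ (H : FockModule q e n) (r c : Fin n → ℂ) (i j : ℕ) :
    Module.End ℂ H.V :=
  (extendOne r i * extendOne (fun k => c k.rev) j) • H.Z i j

theorem scaledZ_rev (H : FockModule q e n) (r c : Fin n → ℂ) (i j : Fin n) :
    scaledZ H r c i j.rev = (r i * c j) • H.Z i j.rev := by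
  rw [scaledZ, extendOne_coe, extendOne_coe, Fin.rev_rev]

/-- The representation of the modified algebra obtained from a rescaled Fock module. -/
noncomputable def modRep (hq : q ≠ 0) (w : ModificationDatum n) (H : FockModule q e n)
    (r c : Fin n → ℂ) :
    modifiedAlgebra q w →ₐ[ℂ] Module.End ℂ (WeightLattice n → H.V) :=
  (torusRep hq (Y := scaledZ H r c) (H.rel.scale _ _)).comp (modifiedAlgebra q w).val

variable (hq : q ≠ 0) (H : FockModule q e n) (r c : Fin n → ℂ)

theorem modRep_revGen (i j : Fin n) (h : WeightLattice n → H.V) (η : WeightLattice n) :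
    modRep hq w H r c (revGen q w i j) h η = (q ^ weightPairing η (rootZ i j.rev) * (r i * c j)) •
      H.Z i j.rev (h (η + (w.ζ i + w.ξ j.rev))) := by
  refine (torusRep_modZ hq _ w i j.rev h η).trans ?_
  rw [scaledZ_rev, LinearMap.smul_apply, smul_smul]

theorem modRep_revGen_smul (i j : Fin n) (f : WeightLattice n → ℂ) (u : H.V) :
    modRep hq w H r c (revGen q w i j) (fun η => f η • u) =
      fun η => weightedShift q w i j.rev f η • (r i * c j) • H.Z i j.rev u := by
  refine (torusRep_modZ_smul hq _ w i j.rev f u).trans ?_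
  rw [scaledZ_rev]
  rfl

theorem modRep_revGen_pow_smul (i j : Fin n) (k : ℕ) (f : WeightLattice n → ℂ) (u : H.V) :
    ∃ g : WeightLattice n → ℂ, modRep hq w H r c (revGen q w i j ^ k) (fun η => f η • u) =
      fun η => g η • (H.Z i j.rev ^ k) u := by
  induction k with
  | zero => exact ⟨f, by simp⟩
  | succ k ih =>
    obtain ⟨g, hg⟩ := ih
    refine ⟨(r i * c j) • weightedShift q w i j.rev g, ?_⟩
    rw [pow_succ', map_mul, Module.End.mul_apply, hg, modRep_revGen_smul, pow_succ' (H.Z i _)]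
    funext η
    rw [Pi.smul_apply, smul_comm, smul_assoc, Module.End.mul_apply]

/-- The functional of the Fock module, applied pointwise. -/
def pointwiseφ (H : FockModule q e n) : (WeightLattice n → H.V) →ₗ[ℂ] (WeightLattice n → ℂ) :=
  H.φ.compLeft (WeightLattice n)

theorem pointwiseφ_smul (f : WeightLattice n → ℂ) :
    pointwiseφ H (fun η => f η • H.v) = f := by
  funext η
  change H.φ (f η • H.v) = f η
  simp [H.φ_v]

theorem pointwiseφ_upper {i j : Fin n} (hij : i < j) (h : WeightLattice n → H.V) :
    pointwiseφ H (modRep hq w H r c (revGen q w i j) h) = 0 := by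
  funext η
  change H.φ (modRep hq w H r c (revGen q w i j) h η) = 0
  rw [modRep_revGen, map_smul, H.φ_upper, smul_zero]
  rw [Fin.val_rev]
  have : (i : ℕ) < j := hij
  omega

variable {f : WeightLattice n → ℂ}

theorem modRep_lower {i j : Fin n} (hij : j < i) (f : WeightLattice n → ℂ) :
    modRep hq w H r c (revGen q w i j) (fun η => f η • H.v) = 0 := by
  rw [modRep_revGen_smul, H.lower i i.2 _ j.rev.2]
  · simp
    rfl
  · rw [Fin.val_rev]
    have : (j : ℕ) < i := hij
    omega

theorem modRep_diag {s Λ : Fin n → ℂ} (hf : ∀ k : Fin n, weightedShift q w k k.rev f = s k • f)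
    (hs : ∀ k, r k * c k * s k = Λ k) (k : Fin n) :
    modRep hq w H r c (revGen q w k k) (fun η => f η • H.v) = Λ k • fun η => f η • H.v := by
  rw [modRep_revGen_smul, H.diag, hf, ← hs]
  · funext η
    simp [smul_smul]
    ring_nf
  · rw [Fin.val_rev]
    omega

theorem modGen_eq_revGen (i j : Fin n) : modGen q w i j = revGen q w i j.rev := by
  rw [revGen, Fin.rev_rev]

/-- The restricted ideal annihilates the highest weight vector. -/
theorem modRep_eq_zero_of_mem {m : ℕ} (hm : reducedOrder m = e + 1) {s Λ : Fin n → ℂ}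
    (hf : ∀ k : Fin n, weightedShift q w k k.rev f = s k • f) (hs : ∀ k, r k * c k * s k = Λ k)
    {y : modifiedAlgebra q w} (hy : y ∈ restrictedIdeal m q w Λ) :
    modRep hq w H r c y (fun η => f η • H.v) = 0 := by
  let K : Submodule (modifiedAlgebra q w) (modifiedAlgebra q w) :=
    { carrier := {y | modRep hq w H r c y (fun η => f η • H.v) = 0}
      add_mem' := fun {a b} ha hb => by
        rw [Set.mem_ofPred_eq] at ha hb ⊢
        rw [map_add, LinearMap.add_apply, ha, hb, add_zero]
      zero_mem' := by simp
      smul_mem' := fun a b hb => by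
        rw [Set.mem_ofPred_eq] at hb ⊢
        rw [smul_eq_mul, map_mul, Module.End.mul_apply, hb, map_zero] }
  suffices h : restrictedIdeal m q w Λ ≤ K from h hy
  refine Submodule.span_le.2 ?_
  rintro _ ((⟨i, j, hij, rfl⟩ | ⟨k, rfl⟩) | ⟨i, j, hij, rfl⟩)
  · change modRep hq w H r c _ _ = 0
    rw [modGen_eq_revGen]
    refine modRep_lower hq H r c ?_ f
    rw [Fin.lt_def, Fin.val_rev]
    omega
  · change modRep hq w H r c _ _ = 0
    rw [modGen_eq_revGen, Fin.rev_rev, map_sub, LinearMap.sub_apply,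
      modRep_diag hq H r c hf hs k, AlgHom.commutes]
    exact sub_self _
  · change modRep hq w H r c _ _ = 0
    rw [modGen_eq_revGen, hm]
    obtain ⟨g, hg⟩ := modRep_revGen_pow_smul hq (w := w) H r c i j.rev (e + 1) f H.v
    rw [hg, Fin.rev_rev, H.upper_pow i j (by omega)]
    simp
    rfl

theorem modRep_straightening :
    Straightening fun i j => modRep hq w H r c (revGen q w i j) :=
  (straightening_revGen w hq).map _

/-- The values of the functional on the submodule generated by a singular vector. -/
theorem pointwiseφ_mem {s : WeightLattice n → H.V}
    (hlow : ∀ i j, j < i → modRep hq w H r c (revGen q w i j) s = 0)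
    (hdiag : ∀ i, ∃ a : ℂ, modRep hq w H r c (revGen q w i i) s = a • s)
    (y : modifiedAlgebra q w) :
    pointwiseφ H (modRep hq w H r c y s) ∈ ℂ ∙ pointwiseφ H s := by
  obtain ⟨T, h1, h2, h3, -⟩ := (modRep_straightening hq (w := w) H r c).exists_stable s hlow hdiag
  -- The generated subspace is contained in the span of `s` and the images of upper entries, and the
  -- functional kills the latter.
  have := h3 ((ℂ ∙ pointwiseφ H s).comap (pointwiseφ H)) (Submodule.mem_span_singleton_self _) (by
    intro i j hij u
    rw [Submodule.mem_comap, pointwiseφ_upper hq H r c hij]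
    exact zero_mem _)
  exact this (modifiedAlgebra_stable w _ T h2 y s h1)

end ModifiedRep

/-! ### Comparison of dimensions -/

/-- The restricted Verma module has at most the expected dimension. -/
theorem finrank_restrictedVerma_le {n m e : ℕ} {q : ℂ} (hq : q ≠ 0)
    (h1 : (q ^ 2) ^ (e + 1) = 1) (h2 : q ^ 2 ≠ 1) (hm : reducedOrder m = e + 1)
    (w : ModificationDatum n) (Λ : Fin n → ℂ) :
    FiniteDimensional ℂ (RestrictedVerma m q w Λ) ∧
      Module.finrank ℂ (RestrictedVerma m q w Λ) ≤ (e + 1) ^ (∑ i ∈ Finset.range n, i) := by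
  let σ : modifiedAlgebra q w →ₐ[ℂ] Module.End ℂ (RestrictedVerma m q w Λ) :=
    Algebra.lsmul ℂ ℂ (RestrictedVerma m q w Λ)
  let s : RestrictedVerma m q w Λ := Submodule.Quotient.mk 1
  have hσ : ∀ y, σ y s = Submodule.Quotient.mk y := fun y => by
    change y • (Submodule.Quotient.mk 1 : RestrictedVerma m q w Λ) = _
    rw [← Submodule.Quotient.mk_smul, smul_eq_mul, mul_one]
  have hmem : ∀ y ∈ restrictedIdeal m q w Λ, σ y s = 0 := fun y hy => by
    rw [hσ]
    exact (Submodule.Quotient.mk_eq_zero _).2 hy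
  have hgen : ∀ T : Submodule ℂ (RestrictedVerma m q w Λ), s ∈ T →
      (∀ i j, ∀ u ∈ T, σ (revGen q w i j) u ∈ T) → T = ⊤ := by
    intro T hs hT
    rw [eq_top_iff]
    rintro u -
    obtain ⟨y, rfl⟩ := Submodule.Quotient.mk_surjective _ u
    rw [← hσ]
    exact modifiedAlgebra_stable w σ T hT y s hs
  -- The power kills the generator `s` by definition of the ideal. As it commutes up to scalars with
  -- the generators, its kernel is stable, hence everything.
  have hpow : ∀ i j : Fin n, i < j → σ (revGen q w i j) ^ (e + 1) = 0 := by
    intro i j hij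
    rw [← map_pow, ← LinearMap.ker_eq_top]
    refine hgen _ ?_ ?_
    · rw [LinearMap.mem_ker]
      refine hmem _ (Submodule.subset_span (Or.inr ⟨i, j.rev, ?_, ?_⟩))
      · rw [Fin.val_rev]
        have : (i : ℕ) < j := hij
        omega
      · rw [hm]
        rfl
    · intro a b u hu
      rw [LinearMap.mem_ker] at hu ⊢
      obtain ⟨c, hc⟩ := exists_revGen_pow_mul_eq w hq h1 h2 i j a b
      rw [← Module.End.mul_apply, ← map_mul, hc, map_smul, map_mul, LinearMap.smul_apply,
        Module.End.mul_apply, hu, map_zero, smul_zero]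
  obtain ⟨T, g1, g2, -, g4⟩ := ((straightening_revGen w hq).map σ).exists_stable s (by
      intro i j hij
      refine hmem _ (Submodule.subset_span (Or.inl (Or.inl ⟨i, j.rev, ?_, rfl⟩)))
      rw [Fin.val_rev]
      have : (j : ℕ) < i := hij
      omega) (by
      intro i
      refine ⟨Λ i, ?_⟩
      have := hmem _ (Submodule.subset_span (Or.inl (Or.inr ⟨i, rfl⟩)))
      rw [map_sub, LinearMap.sub_apply, sub_eq_zero, AlgHom.commutes] at this
      exact this)
  obtain ⟨g5, g6⟩ := g4 (e + 1) (Nat.succ_pos e) hpow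
  have hT := hgen T g1 g2
  subst hT
  exact ⟨Module.finite_def.2 ((Submodule.fg_top _).1 (Module.finite_def.1 g5)), by
    rwa [finrank_top] at g6⟩

/-- The cyclic module generated by the highest weight vector has at least the expected
dimension. -/
theorem le_finrank_of_modRep_mem {n e : ℕ} {q : ℂ} (hq : q ≠ 0) (w : ModificationDatum n)
    (H : FockModule q e n) {r c : Fin n → ℂ} (hr : ∀ k, r k ≠ 0) (hc : ∀ k, c k ≠ 0)
    {f : WeightLattice n → ℂ} (hf : f ≠ 0) (R : Submodule ℂ (WeightLattice n → H.V))
    [FiniteDimensional ℂ R] (hfR : (fun η => f η • H.v) ∈ R)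
    (hR : ∀ i j, ∀ u ∈ R, modRep hq w H r c (revGen q w i j) u ∈ R) :
    (e + 1) ^ (∑ i ∈ Finset.range n, i) ≤ Module.finrank ℂ R := by
  have := H.finite
  -- `R` need not be a tensor product, so one collects the vectors occurring in `R` with some
  -- nonzero function. Generators preserve pure tensors, so cyclicity of `H` makes these vectors
  -- span.
  let 𝒲 : Set H.V := {u | ∃ g : WeightLattice n → ℂ, g ≠ 0 ∧ (fun η => g η • u) ∈ R}
  have hspan : Submodule.span ℂ 𝒲 = ⊤ := by
    refine H.cyclic _ (Submodule.subset_span ⟨f, hf, hfR⟩) ?_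
    intro i hi j hj
    suffices h : Submodule.span ℂ 𝒲 ≤ (Submodule.span ℂ 𝒲).comap (H.Z i j) from h
    refine Submodule.span_le.2 ?_
    rintro u ⟨g, hg, hgu⟩
    have h1 := hR ⟨i, hi⟩ (Fin.rev ⟨j, hj⟩) _ hgu
    rw [modRep_revGen_smul, Fin.rev_rev] at h1
    have h2 := (Submodule.smul_mem_iff (Submodule.span ℂ 𝒲)
      (mul_ne_zero (hr ⟨i, hi⟩) (hc (Fin.rev ⟨j, hj⟩)))).1
      (Submodule.subset_span ⟨_, weightedShift_ne_zero hq w ⟨i, hi⟩ ⟨j, hj⟩ hg, h1⟩)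
    exact h2
  obtain ⟨b, hb1, hb2, hb3⟩ := exists_linearIndependent ℂ 𝒲
  have : Finite b := hb3.finite
  have : Fintype b := Fintype.ofFinite b
  let B := Module.Basis.mk hb3 (by rw [Subtype.range_coe, hb2, hspan])
  choose g hg hgR using fun x : b => hb1 x.2
  have hind : LinearIndependent ℂ fun x : b => (⟨_, hgR x⟩ : R) := by
    rw [Fintype.linearIndependent_iff]
    intro a ha x
    -- Evaluation at a point where `g x` does not vanish reduces independence to that of the chosen
    -- basis of `H.V`.
    obtain ⟨η, hη⟩ := Function.ne_iff.1 (hg x)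
    have h1 := congr_fun (congrArg Subtype.val ha) η
    have h2 : ∑ y : b, (a y * g y η) • (y : H.V) = 0 := by
      refine Eq.trans ?_ h1
      simp [Finset.sum_apply, smul_smul]
    have h3 := Fintype.linearIndependent_iff.1 hb3 _ h2 x
    exact (mul_eq_zero.1 h3).resolve_right hη
  have h1 := hind.fintype_card_le_finrank
  rwa [← Module.finrank_eq_card_basis B, H.finrank] at h1

/-- As `ψ` factors through `π`, its range is a quotient of `M`, and the dimension bound leaves no
room for a kernel. -/
theorem ker_le_ker_of_finrank_le {A M W : Type*} [AddCommGroup A] [Module ℂ A] [AddCommGroup M]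
    [Module ℂ M] [AddCommGroup W] [Module ℂ W] [FiniteDimensional ℂ M] (π : A →ₗ[ℂ] M)
    (ψ : A →ₗ[ℂ] W) (hπ : Function.Surjective π) (hle : LinearMap.ker π ≤ LinearMap.ker ψ)
    (h : FiniteDimensional ℂ (LinearMap.range ψ) →
      Module.finrank ℂ M ≤ Module.finrank ℂ (LinearMap.range ψ)) :
    LinearMap.ker ψ ≤ LinearMap.ker π := by
  obtain ⟨g, hg⟩ := π.exists_rightInverse_of_surjective (LinearMap.range_eq_top.2 hπ)
  have hg' : ∀ u, π (g u) = u := fun u => LinearMap.congr_fun hg u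
  have hψ : ∀ y, (ψ ∘ₗ g) (π y) = ψ y := by
    intro y
    have : g (π y) - y ∈ LinearMap.ker ψ := hle (by rw [LinearMap.mem_ker, map_sub, hg', sub_self])
    rwa [LinearMap.mem_ker, map_sub, sub_eq_zero] at this
  have hr : LinearMap.range (ψ ∘ₗ g) = LinearMap.range ψ := by
    refine le_antisymm (LinearMap.range_comp_le_range _ _) ?_
    rintro _ ⟨y, rfl⟩
    exact ⟨π y, hψ y⟩
  rw [← hr] at h
  have h1 := h inferInstance
  have h2 := (ψ ∘ₗ g).finrank_range_add_finrank_ker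
  have hker : LinearMap.ker (ψ ∘ₗ g) = ⊥ := by
    rw [← Submodule.finrank_eq_zero (R := ℂ)]
    omega
  intro y hy
  refine LinearMap.ker_eq_bot.1 hker ?_
  rw [hψ, map_zero]
  exact hy

/-- If all parameters are nonzero, the restricted ideal is the annihilator of the highest weight
vector. -/
theorem mem_restrictedIdeal_of_modRep_eq_zero {n m e : ℕ} {q : ℂ} (hq : q ≠ 0)
    (h1 : (q ^ 2) ^ (e + 1) = 1) (h2 : q ^ 2 ≠ 1) (hm : reducedOrder m = e + 1)
    {w : ModificationDatum n} (H : FockModule q e n) {r c : Fin n → ℂ} (hr : ∀ k, r k ≠ 0)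
    (hc : ∀ k, c k ≠ 0) {f : WeightLattice n → ℂ} (hf0 : f ≠ 0) {s Λ : Fin n → ℂ}
    (hf : ∀ k : Fin n, weightedShift q w k k.rev f = s k • f) (hs : ∀ k, r k * c k * s k = Λ k)
    {y : modifiedAlgebra q w} (hy : modRep hq w H r c y (fun η => f η • H.v) = 0) :
    y ∈ restrictedIdeal m q w Λ := by
  obtain ⟨hfin, hdim⟩ := finrank_restrictedVerma_le hq h1 h2 hm w Λ
  let π : modifiedAlgebra q w →ₗ[ℂ] RestrictedVerma m q w Λ :=
    (restrictedIdeal m q w Λ).mkQ.restrictScalars ℂ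
  have hπ : ∀ y, π y = 0 ↔ y ∈ restrictedIdeal m q w Λ := fun y =>
    Submodule.Quotient.mk_eq_zero _
  have hπs : Function.Surjective π :=
    (restrictedIdeal m q w Λ).mkQ_surjective
  let ψ : modifiedAlgebra q w →ₗ[ℂ] (WeightLattice n → H.V) :=
    LinearMap.applyₗ (fun η => f η • H.v) ∘ₗ (modRep hq w H r c).toLinearMap
  have hψ : ∀ y, ψ y = modRep hq w H r c y (fun η => f η • H.v) := fun _ => rfl
  have hle : LinearMap.ker π ≤ LinearMap.ker ψ := fun y hy => by
    rw [LinearMap.mem_ker, hψ]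
    exact modRep_eq_zero_of_mem hq H r c hm hf hs ((hπ y).1 hy)
  rw [← hπ]
  refine ker_le_ker_of_finrank_le π ψ hπs hle (fun _ => hdim.trans ?_) (x := y) hy
  refine le_finrank_of_modRep_mem hq w H hr hc hf0 (LinearMap.range ψ) ⟨1, ?_⟩ ?_
  · rw [hψ, map_one]
    rfl
  · rintro i j _ ⟨y, rfl⟩
    exact ⟨revGen q w i j * y, by rw [hψ, hψ, map_mul]; rfl⟩

/-! ### Singular vectors and the irreducibility criterion -/

/-- A nonzero subspace stable under the lower generators contains a nonzero vector annihilated by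
them. -/
theorem exists_singular {n e : ℕ} {q : ℂ} (hq : q ≠ 0) (w : ModificationDatum n)
    (H : FockModule q e n) (r c : Fin n → ℂ) (U : Submodule ℂ (WeightLattice n → H.V))
    (hU : ∀ i j, ∀ u ∈ U, modRep hq w H r c (revGen q w i j) u ∈ U) (hU0 : U ≠ ⊥) :
    ∃ u ∈ U, u ≠ 0 ∧ ∀ i j, j < i → modRep hq w H r c (revGen q w i j) u = 0 := by
  -- The index is shifted by one so that `k = 0` means degree `-1`, where the filtration is zero.
  have key : ∀ k : ℕ, ∀ u ∈ U, u ≠ 0 → (∀ η, u η ∈ H.fil ((k : ℤ) - 1)) →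
      ∃ u ∈ U, u ≠ 0 ∧ ∀ i j, j < i → modRep hq w H r c (revGen q w i j) u = 0 := by
    intro k
    induction k with
    | zero =>
      intro u _ hu0 hfil
      refine absurd (funext fun η => ?_) hu0
      have := hfil η
      rwa [H.fil_neg _ (by simp), Submodule.mem_bot] at this
    | succ k ih =>
      intro u hu hu0 hfil
      by_cases hall : ∀ i j, j < i → modRep hq w H r c (revGen q w i j) u = 0
      · exact ⟨u, hu, hu0, hall⟩
      push Not at hall
      obtain ⟨i, j, hij, hne⟩ := hall
      refine ih _ (hU i j u hu) hne fun η => ?_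
      rw [modRep_revGen]
      refine Submodule.smul_mem _ _ (H.fil_mono ?_ (H.fil_apply i i.2 _ j.rev.2 _ _ (hfil _)))
      rw [Fin.val_rev]
      have : (j : ℕ) < i := hij
      omega
  obtain ⟨u, hu, hu0⟩ := (Submodule.ne_bot_iff _).1 hU0
  obtain ⟨k, hk⟩ := H.fil_top
  refine key (k + 1).toNat u hu hu0 fun η => ?_
  refine H.fil_mono (show k ≤ _ by omega) ?_
  rw [hk]
  trivial

theorem isSimpleModule_restrictedVerma {n m e : ℕ} {q : ℂ} (hq : q ≠ 0)
    (h1 : (q ^ 2) ^ (e + 1) = 1) (h2 : q ^ 2 ≠ 1) (hm : reducedOrder m = e + 1)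
    {w : ModificationDatum n} (H : FockModule q e n) {f : WeightLattice n → ℂ} (hf0 : f ≠ 0)
    {s Λ : Fin n → ℂ} (hs : ∀ k, s k ≠ 0) (hΛ : ∀ k, Λ k ≠ 0)
    (hf : ∀ k : Fin n, weightedShift q w k k.rev f = s k • f) :
    IsSimpleModule (modifiedAlgebra q w) (RestrictedVerma m q w Λ) := by
  set r : Fin n → ℂ := fun k => Λ k / s k
  set c : Fin n → ℂ := fun _ => 1
  have hr : ∀ k, r k ≠ 0 := fun k => div_ne_zero (hΛ k) (hs k)
  have hrc : ∀ k, r k * c k * s k = Λ k := fun k => by simp [r, c, hs k]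
  set w0 : WeightLattice n → H.V := fun η => f η • H.v with hw0
  have hmem : ∀ y : modifiedAlgebra q w,
      y ∈ restrictedIdeal m q w Λ ↔ modRep hq w H r c y w0 = 0 := fun y =>
    ⟨fun hy => modRep_eq_zero_of_mem hq H r c hm hf hrc hy, fun hy =>
      mem_restrictedIdeal_of_modRep_eq_zero hq h1 h2 hm H hr (fun _ => one_ne_zero) hf0 hf hrc hy⟩
  have hφ : pointwiseφ H w0 = f := pointwiseφ_smul H f
  rw [isSimpleModule_iff_isCoatom]
  refine ⟨fun h => ?_, fun J hJ => ?_⟩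
  · have h3 : (1 : modifiedAlgebra q w) ∈ restrictedIdeal m q w Λ := by
      rw [h]
      trivial
    rw [hmem, map_one, Module.End.one_apply] at h3
    rw [h3, map_zero] at hφ
    exact hf0 hφ.symm
  · obtain ⟨y, hyJ, hyI⟩ := SetLike.exists_of_lt hJ
    let U : Submodule ℂ (WeightLattice n → H.V) := (J.restrictScalars ℂ).map
      (LinearMap.applyₗ w0 ∘ₗ (modRep hq w H r c).toLinearMap)
    have hU : ∀ u, u ∈ U ↔ ∃ y ∈ J, modRep hq w H r c y w0 = u := fun u => Iff.rfl
    obtain ⟨u, huU, hu0, hlow⟩ := exists_singular hq w H r c U (by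
        rintro i j _ ⟨y, hy, rfl⟩
        rw [hU]
        exact ⟨revGen q w i j * y, J.smul_mem _ hy, by rw [map_mul]; rfl⟩)
      ((Submodule.ne_bot_iff _).2 ⟨_, ⟨y, hyJ, rfl⟩, fun h => hyI ((hmem y).2 h)⟩)
    -- Evaluating at a translated point isolates `u η`. Since `r` and `c` have no zeros, `u η` is
    -- singular in `H`.
    have hsing : ∀ η, ∃ a : ℂ, u η = a • H.v := by
      intro η
      refine H.sing _ fun i hi j hj hij => ?_
      have h3 := congr_fun (hlow ⟨i, hi⟩ (Fin.rev ⟨j, hj⟩) (by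
        rw [Fin.lt_def, Fin.val_rev]
        dsimp only
        omega)) (η - (w.ζ ⟨i, hi⟩ + w.ξ ⟨j, hj⟩))
      rw [modRep_revGen, Fin.rev_rev, sub_add_cancel] at h3
      refine (smul_eq_zero.1 h3).resolve_left ?_
      exact mul_ne_zero (zpow_ne_zero _ hq) (mul_ne_zero (hr _) one_ne_zero)
    choose g hg using hsing
    obtain rfl : u = fun η => g η • H.v := funext hg
    obtain ⟨y', hy', hy'u⟩ := (hU _).1 huU
    have h4 := pointwiseφ_mem hq H r c (s := w0)
      (fun i j hij => modRep_lower hq H r c hij f)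
      (fun i => ⟨_, modRep_diag hq H r c hf hrc i⟩) y'
    rw [hy'u, hφ, pointwiseφ_smul] at h4
    obtain ⟨a, rfl⟩ := Submodule.mem_span_singleton.1 h4
    have ha : a ≠ 0 := by
      rintro rfl
      exact hu0 (funext fun η => by simp)
    have h5 : y' - algebraMap ℂ _ a ∈ restrictedIdeal m q w Λ := by
      rw [hmem, map_sub, LinearMap.sub_apply, hy'u, AlgHom.commutes, sub_eq_zero]
      funext η
      exact mul_smul a (f η) H.v
    have h6 : algebraMap ℂ (modifiedAlgebra q w) a ∈ J := by
      have := J.sub_mem hy' (hJ.le h5)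
      rwa [sub_sub_cancel] at this
    have h7 := J.smul_mem (algebraMap ℂ (modifiedAlgebra q w) a⁻¹) h6
    rw [smul_eq_mul, ← map_mul, inv_mul_cancel₀ ha, map_one] at h7
    exact (Ideal.eq_top_iff_one J).2 h7

/-- For neighbours `a`, `b`, applying a lower entry to `X a b w0` can leave only a multiple of `Λ a
* Λ b`, so this vector is singular when the product vanishes. -/
theorem not_isSimpleModule_restrictedVerma {n m e : ℕ} (hn : 2 ≤ n) {q : ℂ} (hq : q ≠ 0)
    (hm : reducedOrder m = e + 1) {w : ModificationDatum n} (H : FockModule q e n)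
    {f : WeightLattice n → ℂ} (hf0 : f ≠ 0) {s Λ : Fin n → ℂ} (hs : ∀ k, s k ≠ 0)
    (hf : ∀ k : Fin n, weightedShift q w k k.rev f = s k • f) {k : Fin n} (hk : Λ k = 0) :
    ¬ IsSimpleModule (modifiedAlgebra q w) (RestrictedVerma m q w Λ) := by
  obtain ⟨a, b, hab, hΛ⟩ : ∃ a b : Fin n, (b : ℕ) = a + 1 ∧ Λ a * Λ b = 0 := by
    by_cases h : (k : ℕ) + 1 < n
    · exact ⟨k, ⟨k + 1, h⟩, rfl, by rw [hk, zero_mul]⟩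
    · have := k.2
      exact ⟨⟨k - 1, by omega⟩, k, by dsimp only; omega, by rw [hk, mul_zero]⟩
  have hlt : a < b := by
    rw [Fin.lt_def]
    omega
  -- The zero eigenvalue must not kill `X a b w0`. With `r a = c b = 1`, the factors `Λ a` and `Λ b`
  -- sit in column `a` and row `b` instead.
  set r : Fin n → ℂ := fun i => if i = a then 1 else Λ i / s i with hr
  set c : Fin n → ℂ := fun j => if j = a then Λ j / s j else 1 with hc
  have hrc : ∀ k, r k * c k * s k = Λ k := fun k => by
    by_cases h : k = a <;> simp [r, c, h, hs]
  set w0 : WeightLattice n → H.V := fun η => f η • H.v with hw0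
  have hlow0 : ∀ i j, j < i → modRep hq w H r c (revGen q w i j) w0 = 0 :=
    fun i j hij => modRep_lower hq H r c hij f
  have hdiag0 : ∀ i, modRep hq w H r c (revGen q w i i) w0 = Λ i • w0 :=
    modRep_diag hq H r c hf hrc
  have hstr := modRep_straightening hq (w := w) H r c
  set s' := modRep hq w H r c (revGen q w a b) w0 with hs'
  have hs'0 : s' ≠ 0 := by
    intro h
    rw [hs', modRep_revGen_smul] at h
    obtain ⟨η, hη⟩ := Function.ne_iff.1 (weightedShift_ne_zero hq w a b.rev hf0)
    have h1 := (smul_eq_zero.1 (congr_fun h η)).resolve_left hη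
    rw [show r a * c b = 1 by simp [r, c, hlt.ne'], one_smul] at h1
    refine H.upper_ne a b.rev ?_ h1
    rw [Fin.val_rev]
    omega
  have hlow : ∀ i j, j < i → modRep hq w H r c (revGen q w i j) s' = 0 := by
    intro i j hij
    by_cases hcr : a < i ∧ j < b
    · obtain ⟨p, p', h⟩ := hstr.apply_cross hcr.1 hcr.2
      rw [hs', h, hlow0 i j hij, map_zero, smul_zero, zero_add]
      rcases eq_or_ne i b with rfl | hib
      · rw [hdiag0, map_smul]
        rcases eq_or_ne j a with rfl | hja
        · rw [hdiag0, smul_smul, smul_smul, mul_assoc, mul_comm (Λ i), hΛ, mul_zero, zero_smul]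
        · have hja' : j < a := by
            have := hcr.2
            omega
          rw [hlow0 a j hja', smul_zero, smul_zero]
      · have hib' : b < i := by
          have := hcr.1
          omega
        rw [hlow0 i b hib', map_zero, smul_zero]
    · obtain ⟨p, h⟩ := hstr.apply_skew (i := i) (j := j) (a := a) (b := b)
        (fun h => absurd (h.1.trans (hlt.trans h.2)) (not_lt.2 hij.le)) hcr
      rw [hs', h, hlow0 i j hij, map_zero, smul_zero]
  have hdiag : ∀ i, ∃ p : ℂ, modRep hq w H r c (revGen q w i i) s' = p • s' := by
    intro i
    obtain ⟨p, h⟩ := hstr.apply_skew (i := i) (j := i) (a := a) (b := b)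
      (fun h => absurd (h.1.trans (hlt.trans h.2)) (lt_irrefl _)) (fun h => by
        have h1 := h.1
        have h2 := h.2
        rw [Fin.lt_def] at h1 h2
        omega)
    refine ⟨p * Λ i, ?_⟩
    rw [hs', h, hdiag0, map_smul, smul_smul]
  rw [isSimpleModule_iff_isCoatom]
  intro hco
  have hnot : revGen q w a b ∉ restrictedIdeal m q w Λ := fun h =>
    hs'0 (modRep_eq_zero_of_mem hq H r c hm hf hrc h)
  have htop := hco.2 (restrictedIdeal m q w Λ ⊔ Submodule.span _ {revGen q w a b})
    (lt_of_le_of_ne le_sup_left fun h => hnot (by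
      rw [h]
      exact Submodule.mem_sup_right (Submodule.mem_span_singleton_self _)))
  have h1 : (1 : modifiedAlgebra q w) ∈
      restrictedIdeal m q w Λ ⊔ Submodule.span _ {revGen q w a b} := by
    rw [htop]
    trivial
  obtain ⟨x, hx, z, hz, hxz⟩ := Submodule.mem_sup.1 h1
  obtain ⟨y, rfl⟩ := Submodule.mem_span_singleton.1 hz
  have h2 : modRep hq w H r c y s' = w0 := by
    have h3 := modRep_eq_zero_of_mem hq H r c hm hf hrc hx
    have h4 : modRep hq w H r c (x + y • revGen q w a b) w0 = w0 := by
      rw [hxz, map_one]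
      rfl
    rw [map_add, LinearMap.add_apply, h3, zero_add, smul_eq_mul, map_mul] at h4
    exact h4
  -- The functional vanishes on `s'`, an image of an upper entry, hence on all that `s'` generates,
  -- whereas it sends `w0` to `f`.
  have h3 := pointwiseφ_mem hq H r c hlow hdiag y
  rw [h2, hs', pointwiseφ_upper hq H r c hlt, Submodule.span_zero_singleton, Submodule.mem_bot,
    pointwiseφ_smul] at h3
  exact hf0 h3

/-- If the antidiagonal generators commute, so do the weighted shifts which they induce. -/
theorem weightedShift_comm {n e : ℕ} {q : ℂ} (hq : q ≠ 0) {w : ModificationDatum n}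
    (H : FockModule q e n) (hw : AntidiagonalCommutes q w) (k l : Fin n) :
    weightedShift q w k k.rev * weightedShift q w l l.rev =
      weightedShift q w l l.rev * weightedShift q w k k.rev := by
  refine LinearMap.ext fun f => ?_
  -- Without rescaling, and because `v` has eigenvalues `1`, an antidiagonal generator acts on `g ⊗
  -- v` purely by its weighted shift.
  have h0 : ∀ (i : Fin n) (g : WeightLattice n → ℂ),
      modRep hq w H (fun _ => 1) (fun _ => 1) (modGen q w i i.rev) (fun η => g η • H.v) =
        fun η => weightedShift q w i i.rev g η • H.v := by
    intro i g
    rw [modGen_eq_revGen, Fin.rev_rev, modRep_revGen_smul, H.diag i i.rev (by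
      rw [Fin.val_rev]
      omega)]
    simp
  have h1 := congrArg (fun y => pointwiseφ H
    (modRep hq w H (fun _ => 1) (fun _ => 1) y (fun η => f η • H.v))) (hw k l)
  simpa only [map_mul, Module.End.mul_apply, h0, pointwiseφ_smul] using h1

/-- `m'` is the order of `q ^ 2`, and `m > 2` makes it larger than `1`. -/
theorem reducedOrder_spec {m : ℕ} (hm : 2 < m) {q : ℂ} (hq : IsPrimitiveRoot q m) :
    ∃ e, 0 < e ∧ reducedOrder m = e + 1 ∧ ∀ p, q ^ (2 * p) = 1 ↔ e + 1 ∣ p := by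
  have key : 1 < reducedOrder m ∧ ∀ p, m ∣ 2 * p ↔ reducedOrder m ∣ p := by
    unfold reducedOrder
    split_ifs with h
    · obtain ⟨k, rfl⟩ := h
      rw [show (k + k) / 2 = k by omega]
      refine ⟨by omega, fun p => ?_⟩
      rw [← two_mul]
      exact Nat.mul_dvd_mul_iff_left two_pos
    · refine ⟨by omega, fun p => ?_⟩
      exact (Nat.coprime_two_right.2 (Nat.not_even_iff_odd.1 h)).dvd_mul_left
  refine ⟨reducedOrder m - 1, by omega, by omega, fun p => ?_⟩
  rw [hq.pow_eq_one_iff_dvd, key.2, Nat.sub_add_cancel key.1.le]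

theorem mainTheorem5 (n m : ℕ) (hn : 2 ≤ n) (hm : 2 < m) (q : ℂ) (hq : IsPrimitiveRoot q m)
    (w : ModificationDatum n) (hw : AntidiagonalCommutes q w) (Λ : Fin n → ℂ) :
    IsSimpleModule (modifiedAlgebra q w) (RestrictedVerma m q w Λ) ↔ ∀ i, Λ i ≠ 0 := by
  have hq0 : q ≠ 0 := hq.ne_zero (by omega)
  obtain ⟨e, he, hme, hpow⟩ := reducedOrder_spec hm hq
  have h1 : q ^ (2 * (e + 1)) = 1 := (hpow _).2 dvd_rfl
  have h2 : ∀ p, 0 < p → p < e + 1 → q ^ (2 * p) ≠ 1 := fun p hp hpe h =>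
    absurd (Nat.le_of_dvd hp ((hpow p).1 h)) (not_le.2 hpe)
  obtain ⟨H⟩ := nonempty_fockModule hq0 h1 h2 he n
  obtain ⟨f, hf0, s, hs, hf⟩ := exists_eigenfunction (by omega) hq.pow_eq_one w
    (weightedShift_comm hq0 H hw)
  refine ⟨fun hsimple i hi => ?_, fun hΛ => ?_⟩
  · exact not_isSimpleModule_restrictedVerma hn hq0 hme H hf0 hs hf hi hsimple
  · exact isSimpleModule_restrictedVerma hq0 (by rw [← pow_mul, h1])
      (by simpa using h2 1 one_pos (by omega)) hme H hf0 hs hΛ hf
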